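/- Let $C$ be a unital $C^*$-algebra. A $C$-$C$-equivalence bimodule is a $C$-$C$-bimodule $Y$ with a full left $C$-valued inner product ${}_C\langle\cdot,\cdot\rangle$ (linear in the first variable) and a full right $C$-valued inner product $\langle\cdot,\cdot\rangle_C$ (linear in the second variable), complete in the resulting norm, such that ${}_C\langle x,y\rangle\cdot z=x\cdot\langle y,z\rangle_C$ and such that each action is by adjointable operators for the inner product of the other side. $\mathrm{Pic}(C)$ is the group of isomorphism classes $[Y]$ of $C$-$C$-equivalence bimodules, with product $[Y][W]=[Y\otimes_C W]$, unit $[C]$ and inverse $[\widetilde Y]$, where $\widetilde Y$ is the dual bimodule. For $\alpha\in\mathrm{Aut}(C)$ let $Y_\alpha$ be the vector space $C$ with $$a\cdot x\cdot b=a\,x\,\alpha(b),\qquad {}_C\langle x,y\rangle=xy^*,\qquad \langle x,y\rangle_C=\alpha^{-1}(x^*y).$$ Then $\alpha\mapsto[Y_\alpha]$ is a homomorphism $\mathrm{Aut}(C)\to\mathrm{Pic}(C)$. Let $\mathrm{Int}(C)=\{\mathrm{Ad}(u) : u\in C \text{ unitary}\}$. Let $A\subset C$ be a unital inclusion of unital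 $C^*$-algebras. Let $\mathrm{Equi}(A,C)$ consist of the pairs $(X,Y)$ of a $C$-$C$-equivalence bimodule $Y$ and a closed subspace $X\subset Y$ such that $a\cdot x\in X$, $x\cdot a\in X$, ${}_C\langle x,y\rangle\in A$ and $\langle x,y\rangle_C\in A$ for all $a\in A$, $x,y\in X$, and such that the closed linear spans satisfy $$\overline{{}_C\langle X,X\rangle}=A=\overline{\langle X,X\rangle_C},\qquad \overline{{}_C\langle Y,X\rangle}=C=\overline{\langle Y,X\rangle_C}.$$ Write $(X,Y)\sim(Z,W)$ if there is an isomorphism $\Phi:Y\to W$ of $C$-$C$-equivalence bimodules with $\Phi(X)=Z$. Then $\mathrm{Pic}(A,C)=\mathrm{Equi}(A,C)/\!\sim$ is a group with product $[X,Y][Z,W]=[X\otimes_A Z,\,Y\otimes_C W]$, where $X\otimes_A Z$ is identified with the closed linear span of $\{x\otimes z : x\in X,\ z\in Z\}$ in $Y\otimes_C W$; its unit is $[A,C]$ and $[X,Y]^{-1}=[\widetilde X,\widetilde Y]$. Let $\mathrm{Aut}(A,C)$ be the group of automorphisms of $C$ that restrict to an automorphism of $A$, and let $\mathrm{Aut}_0(A,C)$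 be its subgroup of automorphisms that fix $A$ pointwise. For $\alpha\in\mathrm{Aut}(A,C)$ let $X_\alpha=A\subset Y_\alpha=C$; then $\pi(\alpha)=[X_\alpha,Y_\alpha]$ defines a homomorphism $\pi:\mathrm{Aut}(A,C)\to\mathrm{Pic}(A,C)$. **Statement.** Let $A$ be a unital $C^*$-algebra for which the sequence $$1\longrightarrow\mathrm{Int}(A)\longrightarrow\mathrm{Aut}(A)\longrightarrow\mathrm{Pic}(A)\longrightarrow1,$$ whose third map is $\alpha\mapsto[Y_\alpha]$, is exact. Let $n\ge2$, and consider the inclusion $A\subset M_n(A)$ given by $a\mapsto a\otimes I_n$. Then $\mathrm{Pic}(A,M_n(A))$ is isomorphic to a semidirect product of $\mathrm{Aut}_0(A,M_n(A))$ by $\mathrm{Pic}(A)$: $$\mathrm{Pic}(A,M_n(A))\cong\mathrm{Aut}_0(A,M_n(A))\rtimes\mathrm{Pic}(A).$$ More precisely, for some action of $\mathrm{Pic}(A)$ on $\mathrm{Aut}_0(A,M_n(A))$ by group automorphisms there is an isomorphism from the semidirect product onto $\mathrm{Pic}(A,M_n(A))$ that sends $\beta\in\mathrm{Aut}_0(A,M_n(A))$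 to $\pi(\beta)$ and sends the class in $\mathrm{Pic}(A)$ of the bimodule of $\alpha\in\mathrm{Aut}(A)$ to $\pi(\alpha\otimes\mathrm{id}_{M_n(\mathbb C)})$. -/

import Mathlib

open scoped TensorProduct Topology

universe u v w

set_option linter.unusedSectionVars false

noncomputable section

/-! ### Bimodules with two algebra-valued inner products -/

/-- A `C`-`C`-bimodule `X` with a left `C`-valued inner product `linner` (linear in the first
variable) and a right `C`-valued inner product `rinner` (linear in the second variable) which
satisfy all the algebraic axioms of an equivalence bimodule. The right action `x · c` is written
`MulOpposite.op c • x`. -/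
class InnerBimodule (C : Type u) (X : Type v) [CStarAlgebra C] [PartialOrder C]
    [AddCommGroup X] [Module ℂ X] [Module C X] [Module Cᵐᵒᵖ X] where
  linner : X → X → C
  rinner : X → X → C
  algebraMap_smul (z : ℂ) (x : X) : algebraMap ℂ C z • x = z • x
  op_algebraMap_smul (z : ℂ) (x : X) : MulOpposite.op (algebraMap ℂ C z) • x = z • x
  smul_op_smul (a b : C) (x : X) :
    a • MulOpposite.op b • x = MulOpposite.op b • a • x
  linner_add (x y z : X) : linner (x + y) z = linner x z + linner y z
  linner_smul (a : C) (x y : X) : linner (a • x) y = a * linner x y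
  star_linner (x y : X) : star (linner x y) = linner y x
  linner_self_nonneg (x : X) : 0 ≤ linner x x
  linner_self_eq_zero (x : X) : linner x x = 0 → x = 0
  rinner_add (x y z : X) : rinner x (y + z) = rinner x y + rinner x z
  rinner_smul (b : C) (x y : X) : rinner x (MulOpposite.op b • y) = rinner x y * b
  star_rinner (x y : X) : star (rinner x y) = rinner y x
  rinner_self_nonneg (x : X) : 0 ≤ rinner x x
  rinner_self_eq_zero (x : X) : rinner x x = 0 → x = 0
  linner_op_smul (b : C) (x y : X) :
    linner (MulOpposite.op b • x) y = linner x (MulOpposite.op (star b) • y)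
  rinner_smul_left (a : C) (x y : X) : rinner (a • x) y = rinner x (star a • y)
  linner_smul_eq (x y z : X) : linner x y • z = MulOpposite.op (rinner y z) • x

namespace InnerBimodule

variable {C : Type u} {X : Type v} [CStarAlgebra C] [PartialOrder C]
  [AddCommGroup X] [Module ℂ X] [Module C X] [Module Cᵐᵒᵖ X] [InnerBimodule C X]

lemma linner_add_right (x y z : X) :
    (linner x (y + z) : C) = linner x y + linner x z := by
  rw [← star_linner, linner_add, star_add, star_linner, star_linner]

lemma linner_smul_right (a : C) (x y : X) : linner x (a • y) = linner x y * star a := by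
  rw [← star_linner, linner_smul, star_mul, star_linner]

lemma rinner_add_left (x y z : X) :
    (rinner (x + y) z : C) = rinner x z + rinner y z := by
  rw [← star_rinner, rinner_add, star_add, star_rinner, star_rinner]

lemma rinner_op_smul_left (b : C) (x y : X) :
    rinner (MulOpposite.op b • x) y = star b * rinner x y := by
  rw [← star_rinner, rinner_smul, star_mul, star_rinner]

lemma linner_csmul (z : ℂ) (x y : X) : (linner (z • x) y : C) = z • linner x y := by
  rw [← algebraMap_smul (C := C), linner_smul, Algebra.smul_def]

lemma linner_csmul_right (z : ℂ) (x y : X) :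
    (linner x (z • y) : C) = star z • linner x y := by
  rw [← star_linner, linner_csmul, star_smul, star_linner]

lemma rinner_csmul (z : ℂ) (x y : X) : (rinner x (z • y) : C) = z • rinner x y := by
  rw [← op_algebraMap_smul (C := C), rinner_smul, Algebra.smul_def, Algebra.commutes]

lemma rinner_csmul_left (z : ℂ) (x y : X) :
    (rinner (z • x) y : C) = star z • rinner x y := by
  rw [← star_rinner, rinner_csmul, star_smul, star_rinner]

lemma smul_csmul (a : C) (z : ℂ) (x : X) : a • z • x = z • a • x := by
  rw [← algebraMap_smul (C := C) z x, ← algebraMap_smul (C := C) z (a • x), smul_smul, smul_smul,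
    Algebra.commutes]

lemma op_smul_csmul (b : C) (z : ℂ) (x : X) :
    MulOpposite.op b • z • x = z • MulOpposite.op b • x := by
  rw [← algebraMap_smul (C := C) z x, ← algebraMap_smul (C := C) z (MulOpposite.op b • x),
    smul_op_smul]

lemma csmul_smul (z : ℂ) (a : C) (x : X) : (z • a) • x = z • a • x := by
  rw [← algebraMap_smul (C := C) z (a • x), smul_smul, Algebra.smul_def]

lemma op_csmul_smul (z : ℂ) (b : C) (x : X) :
    MulOpposite.op (z • b) • x = z • MulOpposite.op b • x := by
  rw [← op_algebraMap_smul (C := C) z (MulOpposite.op b • x), smul_smul, Algebra.smul_def,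
    ← MulOpposite.op_mul, Algebra.commutes]

variable (C) in
/-- The left inner product against a fixed vector, as a linear map. -/
def linnerL (y : X) : X →ₗ[ℂ] C where
  toFun x := linner x y
  map_add' _ _ := linner_add _ _ _
  map_smul' _ _ := linner_csmul _ _ _

variable (C) in
/-- The right inner product against a fixed vector, as a linear map. -/
def rinnerL (x : X) : X →ₗ[ℂ] C where
  toFun y := rinner x y
  map_add' _ _ := rinner_add _ _ _
  map_smul' _ _ := rinner_csmul _ _ _

lemma linner_sum {ι : Type*} (s : Finset ι) (f : ι → X) (y : X) :
    (linner (∑ i ∈ s, f i) y : C) = ∑ i ∈ s, linner (f i) y :=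
  map_sum (linnerL C y) f s

lemma linner_sub (x y z : X) : (linner (x - y) z : C) = linner x z - linner y z :=
  map_sub (linnerL C z) x y

lemma linner_zero (y : X) : (linner (0 : X) y : C) = 0 := map_zero (linnerL C y)

lemma rinner_sub (x y z : X) : (rinner x (y - z) : C) = rinner x y - rinner x z :=
  map_sub (rinnerL C x) y z

lemma rinner_zero (x : X) : (rinner x (0 : X) : C) = 0 := map_zero (rinnerL C x)

lemma linner_sub_right (x y z : X) : (linner x (y - z) : C) = linner x y - linner x z := by
  rw [← star_linner, linner_sub, star_sub, star_linner, star_linner]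

lemma linner_zero_right (y : X) : (linner y (0 : X) : C) = 0 := by
  rw [← star_linner, linner_zero, star_zero]

variable (C) in
lemma ext_linner {x y : X} (h : ∀ z, (linner x z : C) = linner y z) : x = y := by
  rw [← sub_eq_zero]
  apply linner_self_eq_zero (C := C)
  rw [linner_sub, h, sub_self]

variable (C) in
lemma ext_rinner {x y : X} (h : ∀ z, (rinner z x : C) = rinner z y) : x = y := by
  rw [← sub_eq_zero]
  apply rinner_self_eq_zero (C := C)
  rw [rinner_sub, h, sub_self]

lemma rinner_zero_left (y : X) : (rinner (0 : X) y : C) = 0 := by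
  rw [← star_rinner, rinner_zero, star_zero]

variable (C X) in
/-- The norm `‖x‖ = ‖⟨x, x⟩‖ ^ (1 / 2)` of the left inner product. It agrees with the norm
of the right inner product, see `InnerBimodule.norm_linner_self`. -/
abbrev normedAddCommGroup [StarOrderedRing C] : NormedAddCommGroup X :=
  let : Norm X := ⟨fun x => √‖(linner x x : C)‖⟩
  let : CStarModule C X :=
    { inner := fun x y => linner y x
      inner_add_right := linner_add _ _ _
      inner_self_nonneg := linner_self_nonneg _
      inner_self := fun {x} => ⟨linner_self_eq_zero x, fun h => by rw [h, linner_zero]⟩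
      inner_op_smul_right := linner_smul _ _ _
      inner_smul_right_complex := linner_csmul _ _ _
      star_inner := fun _ _ => star_linner _ _
      norm_eq_sqrt_norm_inner_self := fun _ => rfl }
  CStarModule.normedAddCommGroup C

variable (C X) in
/-- The topology of the norm on `X`. -/
abbrev topology [StarOrderedRing C] : TopologicalSpace X :=
  (normedAddCommGroup C X).toUniformSpace.toTopologicalSpace

section norm

variable [StarOrderedRing C]

lemma norm_linner_le (x y : X) :
    letI := normedAddCommGroup C X
    ‖(linner x y : C)‖ ≤ ‖x‖ * ‖y‖ := by
  let : Norm X := ⟨fun x => √‖(linner x x : C)‖⟩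
  let : CStarModule C X :=
    { inner := fun x y => linner y x
      inner_add_right := linner_add _ _ _
      inner_self_nonneg := linner_self_nonneg _
      inner_self := fun {x} => ⟨linner_self_eq_zero x, fun h => by rw [h, linner_zero]⟩
      inner_op_smul_right := linner_smul _ _ _
      inner_smul_right_complex := linner_csmul _ _ _
      star_inner := fun _ _ => star_linner _ _
      norm_eq_sqrt_norm_inner_self := fun _ => rfl }
  have := CStarModule.norm_inner_le (A := C) X (x := y) (y := x)
  rw [mul_comm]
  exact this

lemma norm_sq (x : X) :
    letI := normedAddCommGroup C X
    ‖x‖ ^ 2 = ‖(linner x x : C)‖ := Real.sq_sqrt (norm_nonneg _)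

lemma norm_smul_le (a : C) (x : X) :
    letI := normedAddCommGroup C X
    ‖a • x‖ ≤ ‖a‖ * ‖x‖ := by
  let := normedAddCommGroup C X
  refine (sq_le_sq₀ (norm_nonneg _) (by positivity)).1 ?_
  rw [norm_sq, mul_pow, norm_sq, linner_smul, linner_smul_right]
  calc _ ≤ ‖a‖ * (‖(linner x x : C)‖ * ‖star a‖) :=
        (norm_mul_le _ _).trans (by gcongr; exact norm_mul_le _ _)
    _ = _ := by rw [norm_star]; ring

end norm

end InnerBimodule

/-- The underlying set of the dual bimodule of `X`. -/
def DualBimodule (X : Type v) : Type v := X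

namespace DualBimodule

variable {C : Type u} {X : Type v} [CStarAlgebra C] [PartialOrder C]
  [AddCommGroup X] [Module ℂ X] [Module C X] [Module Cᵐᵒᵖ X]

/-- The element of the dual bimodule that belongs to `x`. -/
def mk (x : X) : DualBimodule X := x

/-- The element of `X` that belongs to an element of the dual bimodule. -/
def get (x : DualBimodule X) : X := x

instance : AddCommGroup (DualBimodule X) := inferInstanceAs (AddCommGroup X)

/-- Complex scalars act on the dual through complex conjugation. -/
instance : Module ℂ (DualBimodule X) where
  smul z x := mk (star z • get x)
  one_smul x := show star (1 : ℂ) • get x = x by rw [star_one, one_smul]; rfl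
  mul_smul a b x := show star (a * b) • get x = star a • star b • get x by
    rw [smul_smul, star_mul']
  smul_zero a := smul_zero (A := X) (star a)
  smul_add a x y := smul_add (A := X) (star a) x y
  add_smul a b x := show star (a + b) • get x = star a • get x + star b • get x by
    rw [star_add, add_smul]
  zero_smul x := show star (0 : ℂ) • get x = (0 : X) by rw [star_zero, zero_smul]

/-- The left action `c · x̃ = (x · c⋆)~` on the dual. -/
instance : Module C (DualBimodule X) where
  smul c x := mk (MulOpposite.op (star c) • get x)
  one_smul x := show MulOpposite.op (star (1 : C)) • get x = x by
    rw [star_one, MulOpposite.op_one, one_smul]; rfl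
  mul_smul a b x := show MulOpposite.op (star (a * b)) • get x =
      MulOpposite.op (star a) • MulOpposite.op (star b) • get x by
    rw [smul_smul, star_mul, MulOpposite.op_mul]
  smul_zero a := smul_zero (A := X) (MulOpposite.op (star a))
  smul_add a x y := smul_add (A := X) (MulOpposite.op (star a)) x y
  add_smul a b x := show MulOpposite.op (star (a + b)) • get x =
      MulOpposite.op (star a) • get x + MulOpposite.op (star b) • get x by
    rw [star_add, MulOpposite.op_add, add_smul]
  zero_smul x := show MulOpposite.op (star (0 : C)) • get x = (0 : X) by
    rw [star_zero, MulOpposite.op_zero, zero_smul]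

/-- The right action `x̃ · c = (c⋆ · x)~` on the dual. -/
instance : Module Cᵐᵒᵖ (DualBimodule X) where
  smul c x := mk (star c.unop • get x)
  one_smul x := show star (1 : C) • get x = x by rw [star_one, one_smul]; rfl
  mul_smul a b x := show star (b.unop * a.unop) • get x = star a.unop • star b.unop • get x by
    rw [smul_smul, star_mul]
  smul_zero a := smul_zero (A := X) (star a.unop)
  smul_add a x y := smul_add (A := X) (star a.unop) x y
  add_smul a b x := show star (a.unop + b.unop) • get x =
      star a.unop • get x + star b.unop • get x by
    rw [star_add, add_smul]
  zero_smul x := show star (0 : C) • get x = (0 : X) by rw [star_zero, zero_smul]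

open InnerBimodule

instance [InnerBimodule C X] : InnerBimodule C (DualBimodule X) where
  linner x y := rinner (get x) (get y)
  rinner x y := linner (get x) (get y)
  algebraMap_smul z x := show MulOpposite.op (star (algebraMap ℂ C z)) • get x = star z • get x by
    rw [← algebraMap_star_comm, op_algebraMap_smul]
  op_algebraMap_smul z x := show star (algebraMap ℂ C z) • get x = star z • get x by
    rw [← algebraMap_star_comm, InnerBimodule.algebraMap_smul]
  smul_op_smul a b x := show MulOpposite.op (star a) • star b • get x =
      star b • MulOpposite.op (star a) • get x from (smul_op_smul _ _ _).symm
  linner_add x y z := rinner_add_left (get x) (get y) (get z)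
  linner_smul a x y := show rinner (MulOpposite.op (star a) • get x) (get y) = _ by
    rw [rinner_op_smul_left, star_star]
  star_linner x y := star_rinner (get x) (get y)
  linner_self_nonneg x := rinner_self_nonneg (get x)
  linner_self_eq_zero x := rinner_self_eq_zero (get x)
  rinner_add x y z := linner_add_right (get x) (get y) (get z)
  rinner_smul a x y := show linner (get x) (star a • get y) = _ by
    rw [linner_smul_right, star_star]
  star_rinner x y := star_linner (get x) (get y)
  rinner_self_nonneg x := linner_self_nonneg (get x)
  rinner_self_eq_zero x := linner_self_eq_zero (get x)
  linner_op_smul b x y := show rinner (star b • get x) (get y) =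
      rinner (get x) (star (star b) • get y) from rinner_smul_left _ _ _
  rinner_smul_left a x y := show linner (MulOpposite.op (star a) • get x) (get y) =
      linner (get x) (MulOpposite.op (star (star a)) • get y) from linner_op_smul _ _ _
  linner_smul_eq x y z := by
    change MulOpposite.op (star (rinner (get x) (get y) : C)) • get z =
      star (linner (get y) (get z) : C) • get x
    rw [star_rinner, star_linner, ← linner_smul_eq]

end DualBimodule

namespace InnerBimodule

variable {C : Type u} {X : Type v} [CStarAlgebra C] [PartialOrder C] [StarOrderedRing C]
  [AddCommGroup X] [Module ℂ X] [Module C X] [Module Cᵐᵒᵖ X] [InnerBimodule C X]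

lemma norm_op_smul_le (b : C) (x : X) :
    letI := normedAddCommGroup C X
    ‖MulOpposite.op b • x‖ ≤ ‖b‖ * ‖x‖ := by
  let := normedAddCommGroup C X
  refine (sq_le_sq₀ (norm_nonneg _) (by positivity)).1 ?_
  rw [norm_sq, mul_pow, norm_sq]
  have h1 : (linner (MulOpposite.op b • x) (MulOpposite.op b • x) : C) ≤
      ((‖b‖ ^ 2 : ℝ) : ℂ) • linner x x := by
    have h0 : (0 : C) ≤ algebraMap ℝ C (‖b‖ ^ 2) - b * star b := by
      rw [sub_nonneg]
      have := IsSelfAdjoint.le_algebraMap_norm_self (IsSelfAdjoint.mul_star_self b)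
      rwa [CStarRing.norm_self_mul_star, ← sq] at this
    obtain ⟨c, hc⟩ := CStarAlgebra.nonneg_iff_eq_star_mul_self.1 h0
    have h2 := linner_self_nonneg (C := C) (MulOpposite.op (star c) • x)
    rw [linner_op_smul, smul_smul, ← MulOpposite.op_mul, star_star, ← hc, MulOpposite.op_sub,
      sub_smul, linner_sub_right, sub_nonneg] at h2
    rw [linner_op_smul, smul_smul, ← MulOpposite.op_mul]
    refine h2.trans (le_of_eq ?_)
    rw [IsScalarTower.algebraMap_apply ℝ ℂ C, op_algebraMap_smul, linner_csmul_right]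
    simp
  refine (CStarAlgebra.norm_le_norm_of_nonneg_of_le (linner_self_nonneg _) h1).trans ?_
  rw [norm_smul]
  simp

lemma norm_linner_self_le (x : X) : ‖(linner x x : C)‖ ≤ ‖(rinner x x : C)‖ := by
  let := normedAddCommGroup C X
  rcases (norm_nonneg (linner x x : C)).eq_or_lt with h | h
  · rw [← h]; exact norm_nonneg _
  refine le_of_mul_le_mul_right ?_ h
  have h1 : ‖(linner x x : C)‖ * ‖(linner x x : C)‖ = ‖(linner x x : C) * linner x x‖ := by
    have := CStarRing.norm_star_mul_self (x := (linner x x : C))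
    rw [star_linner] at this
    exact this.symm
  rw [h1, ← linner_smul, linner_smul_eq]
  refine (norm_linner_le _ _).trans ?_
  rw [← norm_sq, sq, ← mul_assoc]
  gcongr
  exact norm_op_smul_le _ _

/-- The norms of the left and of the right inner product agree. -/
lemma norm_linner_self (x : X) : ‖(linner x x : C)‖ = ‖(rinner x x : C)‖ :=
  le_antisymm (norm_linner_self_le x)
    (norm_linner_self_le (C := C) (DualBimodule.mk x))

/-- A submodule on which the left inner products are dense enough contains vectors
`w i` with `∑ i, ⟨w i, w i⟩ = 1`. -/
lemma exists_frame (S : StarSubalgebra ℂ C) [hS : IsClosed (S : Set C)] (V : Submodule ℂ X)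
    (hact : ∀ a ∈ S, ∀ x ∈ V, a • x ∈ V) (hin : ∀ x ∈ V, ∀ y ∈ V, linner x y ∈ S)
    (hd : (1 : C) ∈ closure
      (Submodule.span ℂ {c : C | ∃ x ∈ V, ∃ y ∈ V, c = linner x y} : Set C)) :
    ∃ (ι : Type) (_ : Fintype ι) (w : ι → X), (∀ i, w i ∈ V) ∧
      ∑ i, (linner (w i) (w i) : C) = 1 := by
  have key : ∀ c ∈ Submodule.span ℂ {c : C | ∃ x ∈ V, ∃ y ∈ V, c = linner x y},
      ∃ (ι : Type) (_ : Fintype ι) (x y : ι → X), (∀ i, x i ∈ V) ∧ (∀ i, y i ∈ V) ∧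
        c = ∑ i, linner (x i) (y i) := by
    intro c hc
    induction hc using Submodule.span_induction with
    | zero => exact ⟨Empty, inferInstance, Empty.elim, Empty.elim, fun i => i.elim,
        fun i => i.elim, by simp⟩
    | add a b _ _ ha hb =>
      obtain ⟨ι, _, x, y, hx, hy, rfl⟩ := ha
      obtain ⟨κ, _, x', y', hx', hy', rfl⟩ := hb
      refine ⟨ι ⊕ κ, inferInstance, Sum.elim x x', Sum.elim y y', ?_, ?_, ?_⟩
      · rintro (i | i)
        exacts [hx i, hx' i]
      · rintro (i | i)
        exacts [hy i, hy' i]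
      · rw [Fintype.sum_sum_type]
        rfl
    | mem a ha =>
      obtain ⟨x, hx, y, hy, rfl⟩ := ha
      exact ⟨Unit, inferInstance, fun _ => x, fun _ => y, fun _ => hx, fun _ => hy, by simp⟩
    | smul z a _ ha =>
      obtain ⟨ι, _, x, y, hx, hy, rfl⟩ := ha
      exact ⟨ι, inferInstance, fun i => z • x i, y, fun i => V.smul_mem _ (hx i), hy, by
        simp only [linner_csmul, Finset.smul_sum]⟩
  obtain ⟨c, hc, hc1⟩ := Metric.mem_closure_iff.1 hd (1 / 2) (by norm_num)
  obtain ⟨ι, _, x, y, hx, hy, rfl⟩ := key c hc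
  set c : C := ∑ i, linner (x i) (y i) with hcdef
  set r : ι ⊕ ι → X := Sum.elim x y with hr
  have hrV : ∀ i, r i ∈ V := by
    rintro (i | i)
    exacts [hx i, hy i]
  set T : C := ∑ i, linner (r i) (r i) with hT
  have hTsa : IsSelfAdjoint T := by
    rw [IsSelfAdjoint, hT, star_sum]
    exact Finset.sum_congr rfl fun i _ => star_linner _ _
  have hTS : T ∈ S := sum_mem fun i _ => hin _ (hrV i) _ (hrV i)
  have hcT : c + star c ≤ T := by
    rw [hT, Fintype.sum_sum_type, hcdef, star_sum, ← Finset.sum_add_distrib,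
      ← Finset.sum_add_distrib]
    refine Finset.sum_le_sum fun i _ => ?_
    have := linner_self_nonneg (C := C) (x i - y i)
    rw [linner_sub, linner_sub_right, linner_sub_right] at this
    rw [star_linner, ← sub_nonneg]
    convert this using 1
    simp only [hr, Sum.elim_inl, Sum.elim_inr]
    abel
  have h1c : (1 : C) ≤ c + star c := by
    have hsa : IsSelfAdjoint ((1 - c) + star (1 - c)) := IsSelfAdjoint.add_star_self _
    have hn : ‖(1 - c) + star (1 - c)‖ ≤ 1 := by
      refine (norm_add_le _ _).trans ?_
      rw [norm_star, ← dist_eq_norm]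
      linarith
    have h2 := hsa.le_algebraMap_norm_self
    have h3 : algebraMap ℝ C ‖(1 - c) + star (1 - c)‖ ≤ algebraMap ℝ C 1 :=
      algebraMap_mono C hn
    rw [map_one] at h3
    have h4 := h2.trans h3
    rw [star_sub, star_one, ← sub_nonneg] at h4
    rw [← sub_nonneg]
    convert h4 using 1
    abel
  have h1T : (1 : C) ≤ T := h1c.trans hcT
  have hspec : ∀ t ∈ spectrum ℝ T, 1 ≤ t := by
    rw [← map_one (algebraMap ℝ C), algebraMap_le_iff_le_spectrum (a := T)] at h1T
    exact h1T
  have hcont : ContinuousOn (fun t : ℝ => (√t)⁻¹) (spectrum ℝ T) := by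
    refine ContinuousOn.inv₀ Real.continuous_sqrt.continuousOn fun t ht => ?_
    exact (Real.sqrt_pos.2 (zero_lt_one.trans_le (hspec t ht))).ne'
  set g : C := cfc (fun t : ℝ => (√t)⁻¹) T with hg
  have hgS : g ∈ S := by
    exact cfc_mem (𝕜' := ℂ) _ hTS
  have hgsa : star g = g := (cfc_predicate (R := ℝ) (p := IsSelfAdjoint) _ T : IsSelfAdjoint g)
  have hgT : g * T * g = 1 := by
    have hT' : cfc (fun t : ℝ => t) T = T := cfc_id' ℝ T
    have hm1 : g * T = cfc (fun t : ℝ => (√t)⁻¹ * t) T := by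
      rw [cfc_mul (fun t : ℝ => (√t)⁻¹) (fun t => t) T hcont continuousOn_id, hT']
    have hm2 : g * T * g = cfc (fun t : ℝ => (√t)⁻¹ * t * (√t)⁻¹) T := by
      rw [cfc_mul (fun t : ℝ => (√t)⁻¹ * t) (fun t => (√t)⁻¹) T (hcont.mul continuousOn_id) hcont,
        hm1]
    rw [hm2, ← cfc_one ℝ T]
    refine cfc_congr fun t ht => ?_
    have := Real.sqrt_pos.2 (zero_lt_one.trans_le (hspec t ht))
    have h' := Real.mul_self_sqrt (zero_le_one.trans (hspec t ht))
    simp only [Pi.one_apply]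
    field_simp
    nlinarith
  refine ⟨ι ⊕ ι, inferInstance, fun i => g • r i, fun i => hact g hgS _ (hrV i), ?_⟩
  simp only [linner_smul, linner_smul_right, hgsa]
  rw [← hgT, hT, Finset.mul_sum, Finset.sum_mul]

end InnerBimodule

/-- `X` is a `C`-`C`-equivalence bimodule: both inner products are full, and `X` is complete. -/
class EquivalenceBimodule (C : Type u) (X : Type v) [CStarAlgebra C] [PartialOrder C]
    [StarOrderedRing C] [AddCommGroup X] [Module ℂ X] [Module C X] [Module Cᵐᵒᵖ X]
    [InnerBimodule C X] : Prop where
  full_left : closure (Submodule.span ℂ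
    {c : C | ∃ x y : X, c = InnerBimodule.linner x y} : Set C) = Set.univ
  full_right : closure (Submodule.span ℂ
    {c : C | ∃ x y : X, c = InnerBimodule.rinner x y} : Set C) = Set.univ
  complete : @CompleteSpace X (InnerBimodule.normedAddCommGroup C X).toUniformSpace

namespace InnerBimodule

variable {C : Type u} {X : Type v} [CStarAlgebra C] [PartialOrder C] [StarOrderedRing C]
  [AddCommGroup X] [Module ℂ X] [Module C X] [Module Cᵐᵒᵖ X] [InnerBimodule C X]

lemma eq_sum_right {ι : Type*} [Fintype ι] {v : ι → X}
    (hv : ∑ i, (rinner (v i) (v i) : C) = 1) (x : X) :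
    x = ∑ i, (linner x (v i) : C) • v i := by
  simp only [linner_smul_eq]
  rw [← Finset.sum_smul, ← Finset.op_sum, hv, MulOpposite.op_one, one_smul]

lemma eq_sum_left {ι : Type*} [Fintype ι] {w : ι → X}
    (hw : ∑ i, (linner (w i) (w i) : C) = 1) (x : X) :
    x = ∑ i, MulOpposite.op (rinner (w i) x : C) • w i := by
  simp only [← linner_smul_eq]
  rw [← Finset.sum_smul, hw, one_smul]

lemma continuous_linner_left (y : X) :
    letI := topology C X
    Continuous fun x : X => (linner x y : C) := by
  let := normedAddCommGroup C X
  refine AddMonoidHomClass.continuous_of_bound (linnerL C y) (‖y‖) fun x => ?_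
  rw [mul_comm]
  exact norm_linner_le x y

lemma isClosed_of_frame (S : StarSubalgebra ℂ C) [hS : IsClosed (S : Set C)]
    (V : Submodule ℂ X) (hact : ∀ a ∈ S, ∀ x ∈ V, a • x ∈ V)
    (hin : ∀ x ∈ V, ∀ y ∈ V, linner x y ∈ S)
    {ι : Type*} [Fintype ι] {v : ι → X} (hvV : ∀ i, v i ∈ V)
    (hv : ∑ i, (rinner (v i) (v i) : C) = 1) : IsClosed[topology C X] (V : Set X) := by
  let := normedAddCommGroup C X
  have : (V : Set X) = ⋂ i, (fun x => (linner x (v i) : C)) ⁻¹' (S : Set C) := by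
    ext x
    simp only [SetLike.mem_coe, Set.mem_iInter, Set.mem_preimage]
    refine ⟨fun hx i => hin x hx _ (hvV i), fun h => ?_⟩
    rw [eq_sum_right hv x]
    exact sum_mem fun i _ => hact _ (h i) _ (hvV i)
  rw [this]
  exact isClosed_iInter fun i => hS.preimage (continuous_linner_left (v i))

/-- Finitely many vectors with `∑ ⟨w i, w i⟩ = 1` generate all inner products. -/
lemma mem_span_of_frame {ι : Type*} [Fintype ι] {w : ι → X}
    (hw : ∑ i, (linner (w i) (w i) : C) = 1) (c : C) (s : Set C)
    (hs : ∀ i, (linner (c • w i) (w i) : C) ∈ s) : c ∈ Submodule.span ℂ s := by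
  have : c = ∑ i, linner (c • w i) (w i) := by
    simp only [linner_smul]
    rw [← Finset.mul_sum, hw, mul_one]
  rw [this]
  exact sum_mem fun i _ => Submodule.subset_span (hs i)

lemma mem_span_of_frame_right {ι : Type*} [Fintype ι] {v : ι → X}
    (hv : ∑ i, (rinner (v i) (v i) : C) = 1) (c : C) (s : Set C)
    (hs : ∀ i, (rinner (MulOpposite.op (star c) • v i) (v i) : C) ∈ s) :
    c ∈ Submodule.span ℂ s := by
  have : c = ∑ i, rinner (MulOpposite.op (star c) • v i) (v i) := by
    simp only [rinner_op_smul_left, star_star]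
    rw [← Finset.mul_sum, hv, mul_one]
  rw [this]
  exact sum_mem fun i _ => Submodule.subset_span (hs i)

lemma completeSpace_of_frame {ι : Type*} [Fintype ι] {v : ι → X}
    (hv : ∑ i, (rinner (v i) (v i) : C) = 1) :
    @CompleteSpace X (normedAddCommGroup C X).toUniformSpace := by
  let := normedAddCommGroup C X
  refine Metric.complete_of_cauchySeq_tendsto fun u hu => ?_
  have h1 : ∀ i, ∃ c : C, Filter.Tendsto (fun n => (linner (u n) (v i) : C)) Filter.atTop
      (nhds c) := by
    intro i
    refine cauchySeq_tendsto_of_complete ?_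
    refine Metric.cauchySeq_iff'.2 fun ε hε => ?_
    obtain ⟨N, hN⟩ := Metric.cauchySeq_iff'.1 hu (ε / (‖v i‖ + 1)) (by positivity)
    refine ⟨N, fun n hn => ?_⟩
    rw [dist_eq_norm, ← linner_sub]
    have h2 := hN n hn
    rw [dist_eq_norm, lt_div_iff₀ (by positivity)] at h2
    refine (norm_linner_le _ _).trans_lt (lt_of_le_of_lt ?_ h2)
    gcongr
    linarith
  choose c hc using h1
  refine ⟨∑ i, c i • v i, ?_⟩
  have h3 : u = fun n => ∑ i, (linner (u n) (v i) : C) • v i := funext fun n => eq_sum_right hv _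
  rw [h3]
  refine tendsto_finsetSum _ fun i _ => ?_
  rw [tendsto_iff_norm_sub_tendsto_zero]
  refine squeeze_zero (fun _ => norm_nonneg _) (g := fun n =>
    ‖(linner (u n) (v i) : C) - c i‖ * ‖v i‖) (fun n => ?_) ?_
  · rw [← sub_smul]
    exact norm_smul_le _ _
  · rw [← zero_mul ‖v i‖]
    exact (tendsto_iff_norm_sub_tendsto_zero.1 (hc i)).mul_const _

end InnerBimodule

namespace EquivalenceBimodule

open InnerBimodule

variable {C : Type u} {X : Type v} [CStarAlgebra C] [PartialOrder C] [StarOrderedRing C]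
  [AddCommGroup X] [Module ℂ X] [Module C X] [Module Cᵐᵒᵖ X]

lemma of_frames [InnerBimodule C X] {ι κ : Type*} [Fintype ι] [Fintype κ] {w : ι → X} {v : κ → X}
    (hw : ∑ i, (linner (w i) (w i) : C) = 1) (hv : ∑ i, (rinner (v i) (v i) : C) = 1) :
    EquivalenceBimodule C X where
  full_left := Set.eq_univ_of_forall fun c => subset_closure <|
    mem_span_of_frame hw c _ fun _ => ⟨_, _, rfl⟩
  full_right := Set.eq_univ_of_forall fun c => subset_closure <|
    mem_span_of_frame_right hv c _ fun _ => ⟨_, _, rfl⟩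
  complete := completeSpace_of_frame hv

instance isClosed_top : IsClosed ((⊤ : StarSubalgebra ℂ C) : Set C) := by
  simp

variable (C X) in
lemma exists_left_frame [InnerBimodule C X] [EquivalenceBimodule C X] :
    ∃ (ι : Type) (_ : Fintype ι) (w : ι → X), ∑ i, (linner (w i) (w i) : C) = 1 := by
  obtain ⟨ι, _, w, -, hw⟩ := exists_frame (C := C) (X := X) ⊤ ⊤ (fun _ _ _ _ => trivial)
    (fun _ _ _ _ => trivial) (by
      have : (1 : C) ∈ Set.univ := trivial
      rw [← full_left (X := X)] at this
      simpa using this)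
  exact ⟨ι, _, w, hw⟩

variable (C X) in
lemma exists_right_frame [InnerBimodule C X] [EquivalenceBimodule C X] :
    ∃ (ι : Type) (_ : Fintype ι) (v : ι → X), ∑ i, (rinner (v i) (v i) : C) = 1 := by
  obtain ⟨ι, _, w, -, hw⟩ := exists_frame (C := C) (X := DualBimodule X) ⊤ ⊤
    (fun _ _ _ _ => trivial) (fun _ _ _ _ => trivial) (by
      have : (1 : C) ∈ Set.univ := trivial
      rw [← full_right (X := X)] at this
      convert this using 5
      simp
      rfl)
  exact ⟨ι, _, w, hw⟩

/-- The dual of an equivalence bimodule. -/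
instance dual [InnerBimodule C X] [EquivalenceBimodule C X] :
    EquivalenceBimodule C (DualBimodule X) := by
  obtain ⟨ι, _, w, hw⟩ := exists_left_frame C X
  obtain ⟨κ, _, v, hv⟩ := exists_right_frame C X
  exact of_frames (X := DualBimodule X) (w := v) (v := w) hv hw

end EquivalenceBimodule

/-! ### The relative tensor product -/

section BTensor

variable (C : Type u) (X : Type v) (Y : Type w) [CStarAlgebra C] [PartialOrder C]
  [AddCommGroup X] [Module ℂ X] [Module C X] [Module Cᵐᵒᵖ X]
  [AddCommGroup Y] [Module ℂ Y] [Module C Y] [Module Cᵐᵒᵖ Y]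

/-- The relations `x · c ⊗ y = x ⊗ c · y`. -/
def balancedRel : Submodule ℂ (X ⊗[ℂ] Y) :=
  Submodule.span ℂ {t | ∃ (x : X) (c : C) (y : Y),
    t = (MulOpposite.op c • x) ⊗ₜ[ℂ] y - x ⊗ₜ[ℂ] (c • y)}

/-- The algebraic relative tensor product `X ⊗_C Y`. For equivalence bimodules over a unital
`C` it is already complete in its norm (see `BTensor.equivalenceBimodule`), so that it coincides
with its completion. -/
def BTensor : Type (max v w) := (X ⊗[ℂ] Y) ⧸ balancedRel C X Y

namespace BTensor

instance : AddCommGroup (BTensor C X Y) :=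
  inferInstanceAs (AddCommGroup ((X ⊗[ℂ] Y) ⧸ balancedRel C X Y))

instance : Module ℂ (BTensor C X Y) :=
  inferInstanceAs (Module ℂ ((X ⊗[ℂ] Y) ⧸ balancedRel C X Y))

variable {X Y}

/-- The class `x ⊗ y` in `X ⊗_C Y`. -/
def tmul (x : X) (y : Y) : BTensor C X Y := (balancedRel C X Y).mkQ (x ⊗ₜ[ℂ] y)

variable {C}

lemma add_tmul (x x' : X) (y : Y) : tmul C (x + x') y = tmul C x y + tmul C x' y := by
  rw [tmul, TensorProduct.add_tmul, map_add]; rfl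

lemma tmul_add (x : X) (y y' : Y) : tmul C x (y + y') = tmul C x y + tmul C x y' := by
  rw [tmul, TensorProduct.tmul_add, map_add]; rfl

lemma csmul_tmul (z : ℂ) (x : X) (y : Y) : tmul C (z • x) y = z • tmul C x y := by
  rw [tmul, ← TensorProduct.smul_tmul', map_smul]; rfl

lemma tmul_csmul (z : ℂ) (x : X) (y : Y) : tmul C x (z • y) = z • tmul C x y := by
  rw [tmul, TensorProduct.tmul_smul, map_smul]; rfl

lemma op_smul_tmul (c : C) (x : X) (y : Y) :
    tmul C (MulOpposite.op c • x) y = tmul C x (c • y) := by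
  refine (Submodule.Quotient.eq _).2 (Submodule.subset_span ⟨x, c, y, rfl⟩)

@[elab_as_elim]
lemma induction {p : BTensor C X Y → Prop} (t : BTensor C X Y) (h0 : p 0)
    (hadd : ∀ s t, p s → p t → p (s + t)) (ht : ∀ x y, p (tmul C x y)) : p t := by
  obtain ⟨t, rfl⟩ := Submodule.mkQ_surjective (balancedRel C X Y) t
  induction t using TensorProduct.induction_on with
  | zero => exact h0
  | tmul x y => exact ht x y
  | add s t hs ht => rw [map_add]; exact hadd _ _ hs ht

section lift

variable {P : Type*} [AddCommGroup P] [Module ℂ P] {σ : ℂ →+* ℂ}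

/-- A (semi)bilinear balanced map induces a (semi)linear map on the relative tensor product. -/
def lift (f : X →ₛₗ[σ] Y →ₛₗ[σ] P)
    (hf : ∀ (x : X) (c : C) (y : Y), f (MulOpposite.op c • x) y = f x (c • y)) :
    BTensor C X Y →ₛₗ[σ] P :=
  (balancedRel C X Y).liftQ (TensorProduct.lift f) <| Submodule.span_le.2 <| by
    rintro _ ⟨x, c, y, rfl⟩
    simp [hf]

@[simp]
lemma lift_tmul (f : X →ₛₗ[σ] Y →ₛₗ[σ] P) (hf) (x : X) (y : Y) :
    lift (C := C) f hf (tmul C x y) = f x y := rfl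

lemma hom_ext {f g : BTensor C X Y →ₛₗ[σ] P} (h : ∀ x y, f (tmul C x y) = g (tmul C x y)) :
    f = g := by
  ext t
  induction t using induction with
  | h0 => simp
  | hadd s t hs ht => rw [map_add, map_add, hs, ht]
  | ht x y => exact h x y

end lift

open InnerBimodule

variable [InnerBimodule C X] [InnerBimodule C Y]

/-- Left multiplication by `c`. -/
def lmul (c : C) : BTensor C X Y →ₗ[ℂ] BTensor C X Y :=
  lift (LinearMap.mk₂ ℂ (fun x y => tmul C (c • x) y)
    (fun x x' y => by rw [smul_add, add_tmul])
    (fun z x y => by rw [smul_csmul, csmul_tmul])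
    (fun x y y' => tmul_add _ _ _)
    (fun z x y => tmul_csmul _ _ _))
    (fun x d y => by
      rw [LinearMap.mk₂_apply, LinearMap.mk₂_apply, smul_op_smul, op_smul_tmul])

/-- Right multiplication by `c`. -/
def rmul (c : C) : BTensor C X Y →ₗ[ℂ] BTensor C X Y :=
  lift (LinearMap.mk₂ ℂ (fun x y => tmul C x (MulOpposite.op c • y))
    (fun x x' y => add_tmul _ _ _)
    (fun z x y => csmul_tmul _ _ _)
    (fun x y y' => by rw [smul_add, tmul_add])
    (fun z x y => by rw [op_smul_csmul, tmul_csmul]))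
    (fun x d y => by
      rw [LinearMap.mk₂_apply, LinearMap.mk₂_apply, ← smul_op_smul, op_smul_tmul])

lemma lmul_tmul (c : C) (x : X) (y : Y) : lmul c (tmul C x y) = tmul C (c • x) y := rfl

lemma rmul_tmul (c : C) (x : X) (y : Y) :
    rmul c (tmul C x y) = tmul C x (MulOpposite.op c • y) := rfl

/-- The left action `c · (x ⊗ y) = (c · x) ⊗ y`. -/
instance : Module C (BTensor C X Y) where
  smul c t := lmul c t
  one_smul t := by
    change lmul (1 : C) t = (LinearMap.id : BTensor C X Y →ₗ[ℂ] BTensor C X Y) t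
    congr 1
    exact hom_ext fun x y => by rw [lmul_tmul, one_smul]; rfl
  mul_smul a b t := by
    change lmul (a * b) t = (lmul a ∘ₗ lmul b) t
    congr 1
    exact hom_ext fun x y => by rw [lmul_tmul, mul_smul]; rfl
  smul_zero a := map_zero (lmul a)
  smul_add a := map_add (lmul a)
  add_smul a b t := by
    change lmul (a + b) t = (lmul a + lmul b : BTensor C X Y →ₗ[ℂ] BTensor C X Y) t
    congr 1
    exact hom_ext fun x y => by rw [lmul_tmul, add_smul, add_tmul]; rfl
  zero_smul t := by
    change lmul (0 : C) t = (0 : BTensor C X Y →ₗ[ℂ] BTensor C X Y) t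
    congr 1
    exact hom_ext fun x y => by
      rw [lmul_tmul, zero_smul, ← zero_smul ℂ (0 : X), csmul_tmul, zero_smul]; rfl

/-- The right action `(x ⊗ y) · c = x ⊗ (y · c)`. -/
instance : Module Cᵐᵒᵖ (BTensor C X Y) where
  smul c t := rmul c.unop t
  one_smul t := by
    change rmul (1 : C) t = (LinearMap.id : BTensor C X Y →ₗ[ℂ] BTensor C X Y) t
    congr 1
    exact hom_ext fun x y => by rw [rmul_tmul, MulOpposite.op_one, one_smul]; rfl
  mul_smul a b t := by
    change rmul (b.unop * a.unop) t = (rmul a.unop ∘ₗ rmul b.unop) t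
    congr 1
    exact hom_ext fun x y => by rw [rmul_tmul, MulOpposite.op_mul, mul_smul]; rfl
  smul_zero a := map_zero (rmul a.unop)
  smul_add a := map_add (rmul a.unop)
  add_smul a b t := by
    change rmul (a.unop + b.unop) t = (rmul a.unop + rmul b.unop : BTensor C X Y →ₗ[ℂ] BTensor C X Y) t
    congr 1
    exact hom_ext fun x y => by rw [rmul_tmul, MulOpposite.op_add, add_smul, tmul_add]; rfl
  zero_smul t := by
    change rmul (0 : C) t = (0 : BTensor C X Y →ₗ[ℂ] BTensor C X Y) t
    congr 1
    exact hom_ext fun x y => by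
      rw [rmul_tmul, MulOpposite.op_zero, zero_smul, ← zero_smul ℂ (0 : Y), tmul_csmul,
        zero_smul]; rfl

lemma smul_tmul (c : C) (x : X) (y : Y) : c • tmul C x y = tmul C (c • x) y := rfl

lemma op_smul_tmul_right (c : C) (x : X) (y : Y) :
    MulOpposite.op c • tmul C x y = tmul C x (MulOpposite.op c • y) := rfl

/-- The left inner product with a pure tensor. -/
def linnerAux (x' : X) (y' : Y) : BTensor C X Y →ₗ[ℂ] C :=
  lift (LinearMap.mk₂ ℂ (fun x y => linner (MulOpposite.op (linner y y' : C) • x) x')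
    (fun x₁ x₂ y => by rw [smul_add, linner_add])
    (fun z x y => by rw [op_smul_csmul, linner_csmul])
    (fun x y₁ y₂ => by rw [linner_add, MulOpposite.op_add, add_smul, linner_add])
    (fun z x y => by rw [linner_csmul, op_csmul_smul, linner_csmul]))
    (fun x c y => by
      rw [LinearMap.mk₂_apply, LinearMap.mk₂_apply, linner_smul, MulOpposite.op_mul, mul_smul])

variable (C X Y) in
/-- The left inner product
`⟨x ⊗ y, x' ⊗ y'⟩ = ⟨x · ⟨y, y'⟩, x'⟩`, as a map that is conjugate linear in `x' ⊗ y'`. -/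
def linnerHom : BTensor C X Y →ₛₗ[starRingEnd ℂ] BTensor C X Y →ₗ[ℂ] C :=
  lift (LinearMap.mk₂'ₛₗ (starRingEnd ℂ) (starRingEnd ℂ) (fun x' y' => linnerAux (C := C) x' y')
    (fun x₁ x₂ y => hom_ext fun a b => linner_add_right _ _ _)
    (fun z x y => hom_ext fun a b => linner_csmul_right _ _ _)
    (fun x y₁ y₂ => hom_ext fun a b => by
      change (linner (MulOpposite.op (linner b (y₁ + y₂) : C) • a) x : C) =
        linner (MulOpposite.op (linner b y₁ : C) • a) x +
        linner (MulOpposite.op (linner b y₂ : C) • a) x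
      rw [linner_add_right, MulOpposite.op_add, add_smul, linner_add])
    (fun z x y => hom_ext fun a b => by
      change (linner (MulOpposite.op (linner b (z • y) : C) • a) x : C) =
        star z • (linner (MulOpposite.op (linner b y : C) • a) x : C)
      rw [linner_csmul_right, op_csmul_smul, linner_csmul]))
    (fun x c y => hom_ext fun a b => by
      change (linner (MulOpposite.op (linner b y : C) • a) (MulOpposite.op c • x) : C) =
        linner (MulOpposite.op (linner b (c • y) : C) • a) x
      rw [linner_smul_right, MulOpposite.op_mul, mul_smul, linner_op_smul (star c), star_star])

/-- The right inner product with a pure tensor. -/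
def rinnerAux (x' : X) (y' : Y) : BTensor C X Y →ₗ[ℂ] C :=
  lift (LinearMap.mk₂ ℂ (fun x y => rinner y' ((rinner x' x : C) • y))
    (fun x₁ x₂ y => by rw [rinner_add, add_smul, rinner_add])
    (fun z x y => by rw [rinner_csmul, csmul_smul, rinner_csmul])
    (fun x y₁ y₂ => by rw [smul_add, rinner_add])
    (fun z x y => by rw [smul_csmul, rinner_csmul]))
    (fun x c y => by
      rw [LinearMap.mk₂_apply, LinearMap.mk₂_apply, rinner_smul, mul_smul])

variable (C X Y) in
/-- The right inner product
`⟨x' ⊗ y', x ⊗ y⟩ = ⟨y', ⟨x', x⟩ · y⟩`, as a map that is conjugate linear in `x' ⊗ y'`. -/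
def rinnerHom : BTensor C X Y →ₛₗ[starRingEnd ℂ] BTensor C X Y →ₗ[ℂ] C :=
  lift (LinearMap.mk₂'ₛₗ (starRingEnd ℂ) (starRingEnd ℂ) (fun x' y' => rinnerAux (C := C) x' y')
    (fun x₁ x₂ y => hom_ext fun a b => by
      change (rinner y ((rinner (x₁ + x₂) a : C) • b) : C) =
        rinner y ((rinner x₁ a : C) • b) + rinner y ((rinner x₂ a : C) • b)
      rw [rinner_add_left, add_smul, rinner_add])
    (fun z x y => hom_ext fun a b => by
      change (rinner y ((rinner (z • x) a : C) • b) : C) =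
        star z • (rinner y ((rinner x a : C) • b) : C)
      rw [rinner_csmul_left, csmul_smul, rinner_csmul])
    (fun x y₁ y₂ => hom_ext fun a b => rinner_add_left _ _ _)
    (fun z x y => hom_ext fun a b => rinner_csmul_left _ _ _))
    (fun x c y => hom_ext fun a b => by
      change (rinner y ((rinner (MulOpposite.op c • x) a : C) • b) : C) =
        rinner (c • y) ((rinner x a : C) • b)
      rw [rinner_op_smul_left, mul_smul, rinner_smul_left])

lemma linnerHom_tmul (x x' : X) (y y' : Y) :
    linnerHom C X Y (tmul C x' y') (tmul C x y) =
      linner (MulOpposite.op (linner y y' : C) • x) x' := rfl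

lemma rinnerHom_tmul (x x' : X) (y y' : Y) :
    rinnerHom C X Y (tmul C x y) (tmul C x' y') = rinner y ((rinner x x' : C) • y') := rfl

/-- The map `x ⊗ y ↦ x · ⟨y, v⟩`. -/
def contractRight (v : Y) : BTensor C X Y →ₗ[ℂ] X :=
  lift (LinearMap.mk₂ ℂ (fun x y => MulOpposite.op (linner y v : C) • x)
    (fun x₁ x₂ y => smul_add _ _ _)
    (fun z x y => op_smul_csmul _ _ _)
    (fun x y₁ y₂ => by rw [linner_add, MulOpposite.op_add, add_smul])
    (fun z x y => by rw [linner_csmul, op_csmul_smul]))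
    (fun x c y => by
      rw [LinearMap.mk₂_apply, LinearMap.mk₂_apply, linner_smul, MulOpposite.op_mul, mul_smul])

/-- The map `x ⊗ y ↦ ⟨w, x⟩ · y`. -/
def contractLeft (w : X) : BTensor C X Y →ₗ[ℂ] Y :=
  lift (LinearMap.mk₂ ℂ (fun x y => (rinner w x : C) • y)
    (fun x₁ x₂ y => by rw [rinner_add, add_smul])
    (fun z x y => by rw [rinner_csmul, csmul_smul])
    (fun x y₁ y₂ => smul_add _ _ _)
    (fun z x y => smul_csmul _ _ _))
    (fun x c y => by
      rw [LinearMap.mk₂_apply, LinearMap.mk₂_apply, rinner_smul, mul_smul])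

lemma contractRight_tmul (v : Y) (x : X) (y : Y) :
    contractRight v (tmul C x y) = MulOpposite.op (linner y v : C) • x := rfl

lemma contractLeft_tmul (w : X) (x : X) (y : Y) :
    contractLeft w (tmul C x y) = (rinner w x : C) • y := rfl

/-- `tmul` as a linear map in the first variable. -/
def tmulL (y : Y) : X →ₗ[ℂ] BTensor C X Y where
  toFun x := tmul C x y
  map_add' _ _ := add_tmul _ _ _
  map_smul' _ _ := csmul_tmul _ _ _

/-- `tmul` as a linear map in the second variable. -/
def tmulR (x : X) : Y →ₗ[ℂ] BTensor C X Y where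
  toFun y := tmul C x y
  map_add' _ _ := tmul_add _ _ _
  map_smul' _ _ := tmul_csmul _ _ _

lemma zero_tmul (y : Y) : tmul C (0 : X) y = 0 := (tmulL y).map_zero

lemma tmul_zero (x : X) : tmul C x (0 : Y) = 0 := (tmulR x).map_zero

section frames

variable [StarOrderedRing C] {ι : Type*} [Fintype ι]

lemma eq_sum_contractRight {v : ι → Y} (hv : ∑ i, (rinner (v i) (v i) : C) = 1)
    (t : BTensor C X Y) : t = ∑ i, tmul C (contractRight (v i) t) (v i) := by
  induction t using induction with
  | h0 => simp only [map_zero]; exact (Finset.sum_eq_zero fun i _ => (tmulL (v i)).map_zero).symm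
  | hadd s t hs ht =>
    conv_lhs => rw [hs, ht]
    rw [← Finset.sum_add_distrib]
    exact Finset.sum_congr rfl fun i _ => by rw [map_add, add_tmul]
  | ht x y =>
    conv_lhs => rw [eq_sum_right hv y]
    change tmulR x _ = _
    rw [map_sum]
    exact Finset.sum_congr rfl fun i _ => (op_smul_tmul _ _ _).symm

lemma eq_sum_contractLeft {w : ι → X} (hw : ∑ i, (linner (w i) (w i) : C) = 1)
    (t : BTensor C X Y) : t = ∑ i, tmul C (w i) (contractLeft (w i) t) := by
  induction t using induction with
  | h0 => simp only [map_zero]; exact (Finset.sum_eq_zero fun i _ => (tmulR (w i)).map_zero).symm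
  | hadd s t hs ht =>
    conv_lhs => rw [hs, ht]
    rw [← Finset.sum_add_distrib]
    exact Finset.sum_congr rfl fun i _ => by rw [map_add, tmul_add]
  | ht x y =>
    conv_lhs => rw [eq_sum_left hw x]
    change tmulL y _ = _
    rw [map_sum]
    exact Finset.sum_congr rfl fun i _ => op_smul_tmul _ _ _

lemma linnerHom_eq_sum {v : ι → Y} (hv : ∑ i, (rinner (v i) (v i) : C) = 1)
    (s t : BTensor C X Y) :
    linnerHom C X Y t s = ∑ i, linner (contractRight (v i) s) (contractRight (v i) t) := by
  induction s using induction with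
  | h0 => simp [linner_zero]
  | hadd s s' hs hs' => simp only [map_add, hs, hs', linner_add, Finset.sum_add_distrib]
  | ht x y =>
  induction t using induction with
  | h0 => simp [linner_zero_right]
  | hadd s s' hs hs' =>
    simp only [map_add, LinearMap.add_apply, hs, hs', linner_add_right, Finset.sum_add_distrib]
  | ht x' y' =>
    simp only [linnerHom_tmul, contractRight_tmul]
    conv_lhs => rw [eq_sum_right hv y]
    simp only [linner_sum, linner_smul, Finset.op_sum, Finset.sum_smul]
    refine Finset.sum_congr rfl fun i _ => ?_
    rw [MulOpposite.op_mul, mul_smul, linner_op_smul (linner (v i) y' : C), star_linner]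

lemma rinnerHom_eq_sum {w : ι → X} (hw : ∑ i, (linner (w i) (w i) : C) = 1)
    (s t : BTensor C X Y) :
    rinnerHom C X Y s t = ∑ i, rinner (contractLeft (w i) s) (contractLeft (w i) t) := by
  induction t using induction with
  | h0 => simp [rinner_zero]
  | hadd s s' hs hs' => simp only [map_add, hs, hs', rinner_add, Finset.sum_add_distrib]
  | ht x y =>
  induction s using induction with
  | h0 => 
    simp only [map_zero, LinearMap.zero_apply]
    refine (Finset.sum_eq_zero fun i _ => ?_).symm
    rw [← star_rinner, rinner_zero, star_zero]
  | hadd s s' hs hs' =>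
    simp only [map_add, LinearMap.add_apply, hs, hs', rinner_add_left, Finset.sum_add_distrib]
  | ht x' y' =>
    simp only [rinnerHom_tmul, contractLeft_tmul]
    conv_lhs => rw [eq_sum_left hw x]
    have h : ∀ f : ι → X, (rinner x' (∑ i, f i) : C) = ∑ i, rinner x' (f i) := fun f =>
      map_sum (rinnerL C x') f _
    have h2 : ∀ f : ι → Y, (rinner y' (∑ i, f i) : C) = ∑ i, rinner y' (f i) := fun f =>
      map_sum (rinnerL C y') f _
    simp only [h, rinner_smul, Finset.sum_smul, h2]
    refine Finset.sum_congr rfl fun i _ => ?_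
    rw [mul_smul, rinner_smul_left (rinner (w i) x' : C), star_rinner]

end frames

variable [StarOrderedRing C] [EquivalenceBimodule C X] [EquivalenceBimodule C Y]

instance : InnerBimodule C (BTensor C X Y) where
  linner s t := linnerHom C X Y t s
  rinner s t := rinnerHom C X Y s t
  algebraMap_smul z t := by
    refine LinearMap.congr_fun (f := lmul (algebraMap ℂ C z))
      (g := z • (LinearMap.id : BTensor C X Y →ₗ[ℂ] BTensor C X Y)) (hom_ext fun x y => ?_) t
    rw [lmul_tmul, InnerBimodule.algebraMap_smul, csmul_tmul]; rfl
  op_algebraMap_smul z t := by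
    refine LinearMap.congr_fun (f := rmul (algebraMap ℂ C z))
      (g := z • (LinearMap.id : BTensor C X Y →ₗ[ℂ] BTensor C X Y)) (hom_ext fun x y => ?_) t
    rw [rmul_tmul, op_algebraMap_smul, tmul_csmul]; rfl
  smul_op_smul a b t := by
    refine LinearMap.congr_fun (f := lmul a ∘ₗ rmul b) (g := rmul b ∘ₗ lmul a)
      (hom_ext fun x y => ?_) t
    rfl
  linner_add r s t := map_add _ _ _
  linner_smul a s t := by
    induction s using induction with
    | h0 => simp
    | hadd s s' hs hs' => rw [smul_add, map_add, map_add, mul_add, hs, hs']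
    | ht x y =>
    induction t using induction with
    | h0 => simp
    | hadd s s' hs hs' => simp only [map_add, LinearMap.add_apply, mul_add, hs, hs']
    | ht x' y' => rw [smul_tmul, linnerHom_tmul, linnerHom_tmul, ← smul_op_smul, linner_smul]
  star_linner s t := by
    obtain ⟨ι, _, v, hv⟩ := EquivalenceBimodule.exists_right_frame C Y
    rw [linnerHom_eq_sum hv, linnerHom_eq_sum hv, star_sum]
    simp only [star_linner]
  linner_self_nonneg t := by
    obtain ⟨ι, _, v, hv⟩ := EquivalenceBimodule.exists_right_frame C Y
    rw [linnerHom_eq_sum hv]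
    exact Finset.sum_nonneg fun i _ => linner_self_nonneg _
  linner_self_eq_zero t ht := by
    obtain ⟨ι, _, v, hv⟩ := EquivalenceBimodule.exists_right_frame C Y
    rw [linnerHom_eq_sum hv, Finset.sum_eq_zero_iff_of_nonneg fun i _ => linner_self_nonneg _]
      at ht
    rw [eq_sum_contractRight hv t]
    refine Finset.sum_eq_zero fun i hi => ?_
    rw [linner_self_eq_zero _ (ht i hi)]
    exact (tmulL (v i)).map_zero
  rinner_add r s t := map_add _ _ _
  rinner_smul a s t := by
    induction t using induction with
    | h0 => simp
    | hadd s s' hs hs' => rw [smul_add, map_add, map_add, add_mul, hs, hs']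
    | ht x y =>
    induction s using induction with
    | h0 => simp
    | hadd s s' hs hs' => simp only [map_add, LinearMap.add_apply, add_mul, hs, hs']
    | ht x' y' =>
      rw [op_smul_tmul_right, rinnerHom_tmul, rinnerHom_tmul, smul_op_smul, rinner_smul]
  star_rinner s t := by
    obtain ⟨ι, _, w, hw⟩ := EquivalenceBimodule.exists_left_frame C X
    rw [rinnerHom_eq_sum hw, rinnerHom_eq_sum hw, star_sum]
    simp only [star_rinner]
  rinner_self_nonneg t := by
    obtain ⟨ι, _, w, hw⟩ := EquivalenceBimodule.exists_left_frame C X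
    rw [rinnerHom_eq_sum hw]
    exact Finset.sum_nonneg fun i _ => rinner_self_nonneg _
  rinner_self_eq_zero t ht := by
    obtain ⟨ι, _, w, hw⟩ := EquivalenceBimodule.exists_left_frame C X
    rw [rinnerHom_eq_sum hw, Finset.sum_eq_zero_iff_of_nonneg fun i _ => rinner_self_nonneg _]
      at ht
    rw [eq_sum_contractLeft hw t]
    refine Finset.sum_eq_zero fun i hi => ?_
    rw [rinner_self_eq_zero _ (ht i hi)]
    exact (tmulR (w i)).map_zero
  linner_op_smul b s t := by
    induction s using induction with
    | h0 => simp
    | hadd s s' hs hs' => rw [smul_add, map_add, map_add, hs, hs']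
    | ht x y =>
    induction t using induction with
    | h0 => simp
    | hadd s s' hs hs' => simp only [smul_add, map_add, LinearMap.add_apply, hs, hs']
    | ht x' y' =>
      rw [op_smul_tmul_right, op_smul_tmul_right, linnerHom_tmul, linnerHom_tmul, linner_op_smul b]
  rinner_smul_left a s t := by
    induction s using induction with
    | h0 => simp
    | hadd s s' hs hs' => simp only [smul_add, map_add, LinearMap.add_apply, hs, hs']
    | ht x y =>
    induction t using induction with
    | h0 => simp
    | hadd s s' hs hs' => rw [smul_add, map_add, map_add, hs, hs']
    | ht x' y' => rw [smul_tmul, smul_tmul, rinnerHom_tmul, rinnerHom_tmul, rinner_smul_left a]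
  linner_smul_eq r s t := by
    induction r using induction with
    | h0 => simp
    | hadd r r' hr hr' => rw [map_add, add_smul, hr, hr', smul_add]
    | ht x y =>
    induction t using induction with
    | h0 => simp
    | hadd t t' h h' => rw [map_add, MulOpposite.op_add, add_smul, ← h, ← h', smul_add]
    | ht x'' y'' =>
    induction s using induction with
    | h0 => simp
    | hadd s s' hs hs' =>
      simp only [map_add, LinearMap.add_apply, MulOpposite.op_add, add_smul, hs, hs']
    | ht x' y' =>
      rw [linnerHom_tmul, rinnerHom_tmul, smul_tmul, op_smul_tmul_right, ← linner_smul_eq y,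
        linner_smul_eq, op_smul_tmul, op_smul_tmul]

lemma linner_tmul (x x' : X) (y y' : Y) :
    (linner (tmul C x y) (tmul C x' y') : C) = linner (MulOpposite.op (linner y y' : C) • x) x' :=
  rfl

lemma rinner_tmul (x x' : X) (y y' : Y) :
    (rinner (tmul C x y) (tmul C x' y') : C) = rinner y ((rinner x x' : C) • y') := rfl

lemma sum_linner_frame {ι κ : Type*} [Fintype ι] [Fintype κ] {w : ι → X} {w' : κ → Y}
    (hw : ∑ i, (linner (w i) (w i) : C) = 1) (hw' : ∑ i, (linner (w' i) (w' i) : C) = 1) :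
    ∑ p : ι × κ, (linner (tmul C (w p.1) (w' p.2)) (tmul C (w p.1) (w' p.2)) : C) = 1 := by
  rw [Fintype.sum_prod_type, ← hw]
  refine Finset.sum_congr rfl fun i _ => ?_
  simp only [linner_tmul]
  rw [← linner_sum, ← Finset.sum_smul, ← Finset.op_sum, hw', MulOpposite.op_one, one_smul]

lemma sum_rinner_frame {ι κ : Type*} [Fintype ι] [Fintype κ] {v : ι → X} {v' : κ → Y}
    (hv : ∑ i, (rinner (v i) (v i) : C) = 1) (hv' : ∑ i, (rinner (v' i) (v' i) : C) = 1) :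
    ∑ p : ι × κ, (rinner (tmul C (v p.1) (v' p.2)) (tmul C (v p.1) (v' p.2)) : C) = 1 := by
  rw [Fintype.sum_prod_type_right, ← hv']
  refine Finset.sum_congr rfl fun j _ => ?_
  simp only [rinner_tmul]
  change ∑ i, rinnerL C (v' j) ((rinner (v i) (v i) : C) • v' j) = _
  rw [← map_sum, ← Finset.sum_smul, hv, one_smul]
  rfl

instance equivalenceBimodule : EquivalenceBimodule C (BTensor C X Y) := by
  obtain ⟨_, _, w, hw⟩ := EquivalenceBimodule.exists_left_frame C X
  obtain ⟨_, _, w', hw'⟩ := EquivalenceBimodule.exists_left_frame C Y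
  obtain ⟨_, _, v, hv⟩ := EquivalenceBimodule.exists_right_frame C X
  obtain ⟨_, _, v', hv'⟩ := EquivalenceBimodule.exists_right_frame C Y
  exact EquivalenceBimodule.of_frames (sum_linner_frame hw hw') (sum_rinner_frame hv hv')

lemma span_tmul :
    Submodule.span ℂ (Set.range fun p : X × Y => tmul C p.1 p.2) = ⊤ := by
  refine eq_top_iff.2 fun t _ => ?_
  induction t using induction with
  | h0 => exact zero_mem _
  | hadd s t hs ht => exact add_mem (hs trivial) (ht trivial)
  | ht x y => exact Submodule.subset_span ⟨(x, y), rfl⟩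

end BTensor

end BTensor

/-! ### Isomorphisms of equivalence bimodules -/

/-- Isomorphisms of `C`-`C`-equivalence bimodules: linear bijections that preserve both actions
and both inner products. -/
structure BimoduleIso (C : Type u) (X : Type v) (Y : Type w) [CStarAlgebra C] [PartialOrder C]
    [AddCommGroup X] [Module ℂ X] [Module C X] [Module Cᵐᵒᵖ X] [InnerBimodule C X]
    [AddCommGroup Y] [Module ℂ Y] [Module C Y] [Module Cᵐᵒᵖ Y] [InnerBimodule C Y] where
  toLinearEquiv : X ≃ₗ[ℂ] Y
  map_smul_left : ∀ (c : C) (x : X), toLinearEquiv (c • x) = c • toLinearEquiv x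
  map_smul_right : ∀ (c : C) (x : X),
    toLinearEquiv (MulOpposite.op c • x) = MulOpposite.op c • toLinearEquiv x
  map_linner : ∀ x x' : X,
    (InnerBimodule.linner (toLinearEquiv x) (toLinearEquiv x') : C) = InnerBimodule.linner x x'
  map_rinner : ∀ x x' : X,
    (InnerBimodule.rinner (toLinearEquiv x) (toLinearEquiv x') : C) = InnerBimodule.rinner x x'

namespace BimoduleIso

open InnerBimodule

variable {C : Type u} {X : Type*} {Y : Type*} {Z : Type*} {X' : Type*} {Y' : Type*}
  [CStarAlgebra C] [PartialOrder C]
  [AddCommGroup X] [Module ℂ X] [Module C X] [Module Cᵐᵒᵖ X] [InnerBimodule C X]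
  [AddCommGroup Y] [Module ℂ Y] [Module C Y] [Module Cᵐᵒᵖ Y] [InnerBimodule C Y]
  [AddCommGroup Z] [Module ℂ Z] [Module C Z] [Module Cᵐᵒᵖ Z] [InnerBimodule C Z]
  [AddCommGroup X'] [Module ℂ X'] [Module C X'] [Module Cᵐᵒᵖ X'] [InnerBimodule C X']
  [AddCommGroup Y'] [Module ℂ Y'] [Module C Y'] [Module Cᵐᵒᵖ Y'] [InnerBimodule C Y']

variable (C X) in
/-- The identity. -/
def refl : BimoduleIso C X X :=
  ⟨LinearEquiv.refl ℂ X, fun _ _ => rfl, fun _ _ => rfl, fun _ _ => rfl, fun _ _ => rfl⟩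

/-- The inverse isomorphism. -/
def symm (Φ : BimoduleIso C X Y) : BimoduleIso C Y X where
  toLinearEquiv := Φ.toLinearEquiv.symm
  map_smul_left c x := by rw [LinearEquiv.symm_apply_eq, Φ.map_smul_left]; simp
  map_smul_right c x := by rw [LinearEquiv.symm_apply_eq, Φ.map_smul_right]; simp
  map_linner x x' := by rw [← Φ.map_linner]; simp
  map_rinner x x' := by rw [← Φ.map_rinner]; simp

/-- The composition of isomorphisms. -/
def trans (Φ : BimoduleIso C X Y) (Ψ : BimoduleIso C Y Z) : BimoduleIso C X Z where
  toLinearEquiv := Φ.toLinearEquiv.trans Ψ.toLinearEquiv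
  map_smul_left c x := by simp [Φ.map_smul_left, Ψ.map_smul_left]
  map_smul_right c x := by simp [Φ.map_smul_right, Ψ.map_smul_right]
  map_linner x x' := by simp [Φ.map_linner, Ψ.map_linner]
  map_rinner x x' := by simp [Φ.map_rinner, Ψ.map_rinner]

/-- Two bimodules that are spanned by families with the same inner products are isomorphic. -/
lemma exists_of_total {S : Type*} (f : S → X) (g : S → Y)
    (hf : Submodule.span ℂ (Set.range f) = ⊤) (hg : Submodule.span ℂ (Set.range g) = ⊤)
    (hl : ∀ s t, (linner (f s) (f t) : C) = linner (g s) (g t))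
    (hr : ∀ s t, (rinner (f s) (f t) : C) = rinner (g s) (g t)) :
    ∃ Φ : BimoduleIso C X Y, ∀ s, Φ.toLinearEquiv (f s) = g s := by
  set F : (S →₀ ℂ) →ₗ[ℂ] X := Finsupp.linearCombination ℂ f with hF
  set G : (S →₀ ℂ) →ₗ[ℂ] Y := Finsupp.linearCombination ℂ g with hG
  have hFs : Function.Surjective F := by
    rw [← LinearMap.range_eq_top, hF, Finsupp.range_linearCombination, hf]
  have hGs : Function.Surjective G := by
    rw [← LinearMap.range_eq_top, hG, Finsupp.range_linearCombination, hg]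
  have hL : ∀ a b, (linner (F a) (F b) : C) = linner (G a) (G b) := by
    intro a b
    induction a using Finsupp.induction_linear with
    | zero => simp [linner_zero]
    | add a a' h h' => simp only [map_add, linner_add, h, h']
    | single s z =>
    induction b using Finsupp.induction_linear with
    | zero => simp [linner_zero_right]
    | add a a' h h' => simp only [map_add, linner_add_right, h, h']
    | single t z' =>
      simp only [hF, hG, Finsupp.linearCombination_single, linner_csmul, linner_csmul_right, hl]
  have hR : ∀ a b, (rinner (F a) (F b) : C) = rinner (G a) (G b) := by
    intro a b
    induction b using Finsupp.induction_linear with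
    | zero => simp [rinner_zero]
    | add a a' h h' => simp only [map_add, rinner_add, h, h']
    | single s z =>
    induction a using Finsupp.induction_linear with
    | zero => simp [rinner_zero_left]
    | add a a' h h' => simp only [map_add, rinner_add_left, h, h']
    | single t z' =>
      simp only [hF, hG, Finsupp.linearCombination_single, rinner_csmul, rinner_csmul_left, hr]
  have hker : LinearMap.ker F = LinearMap.ker G := by
    ext a
    rw [LinearMap.mem_ker, LinearMap.mem_ker]
    constructor
    · intro h
      apply linner_self_eq_zero (C := C)
      rw [← hL, h, linner_zero]
    · intro h
      apply linner_self_eq_zero (C := C)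
      rw [hL, h, linner_zero]
  let Φ : X ≃ₗ[ℂ] Y := (F.quotKerEquivOfSurjective hFs).symm ≪≫ₗ
    Submodule.quotEquivOfEq _ _ hker ≪≫ₗ G.quotKerEquivOfSurjective hGs
  have hΦ : ∀ a, Φ (F a) = G a := by
    intro a
    have : (F.quotKerEquivOfSurjective hFs).symm (F a) = Submodule.Quotient.mk a := by
      rw [LinearEquiv.symm_apply_eq]; rfl
    simp only [Φ, LinearEquiv.trans_apply, this]
    rfl
  have hΦl : ∀ x x', (linner (Φ x) (Φ x') : C) = linner x x' := by
    intro x x'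
    obtain ⟨a, rfl⟩ := hFs x
    obtain ⟨b, rfl⟩ := hFs x'
    rw [hΦ, hΦ, hL]
  have hΦr : ∀ x x', (rinner (Φ x) (Φ x') : C) = rinner x x' := by
    intro x x'
    obtain ⟨a, rfl⟩ := hFs x
    obtain ⟨b, rfl⟩ := hFs x'
    rw [hΦ, hΦ, hR]
  refine ⟨⟨Φ, fun c x => ?_, fun c x => ?_, hΦl, hΦr⟩, fun s => ?_⟩
  · refine ext_linner C fun y => ?_
    obtain ⟨y, rfl⟩ := Φ.surjective y
    rw [hΦl, linner_smul, linner_smul, hΦl]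
  · refine ext_rinner C fun y => ?_
    obtain ⟨y, rfl⟩ := Φ.surjective y
    rw [hΦr, rinner_smul, rinner_smul, hΦr]
  · have : f s = F (Finsupp.single s 1) := by simp [hF]
    rw [this]
    change Φ _ = _
    rw [hΦ]
    simp [hG]

section tensor

variable [StarOrderedRing C] [EquivalenceBimodule C X] [EquivalenceBimodule C Y]
  [EquivalenceBimodule C Z] [EquivalenceBimodule C X'] [EquivalenceBimodule C Y']

open BTensor

lemma exists_congr (Φ : BimoduleIso C X X') (Ψ : BimoduleIso C Y Y') :
    ∃ Θ : BimoduleIso C (BTensor C X Y) (BTensor C X' Y'), ∀ p : X × Y,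
      Θ.toLinearEquiv (tmul C p.1 p.2) = tmul C (Φ.toLinearEquiv p.1) (Ψ.toLinearEquiv p.2) := by
  refine exists_of_total _ _ span_tmul ?_ (fun p q => ?_) (fun p q => ?_)
  · rw [← span_tmul]
    congr 1
    ext t
    constructor
    · rintro ⟨p, rfl⟩
      exact ⟨(_, _), rfl⟩
    · rintro ⟨p, rfl⟩
      exact ⟨(Φ.toLinearEquiv.symm p.1, Ψ.toLinearEquiv.symm p.2), by simp⟩
  · rw [linner_tmul, linner_tmul, Ψ.map_linner, ← Φ.map_smul_right, Φ.map_linner]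
  · rw [rinner_tmul, rinner_tmul, Φ.map_rinner, ← Ψ.map_smul_left, Ψ.map_rinner]

variable (C X Y Z) in
lemma exists_assoc :
    ∃ Θ : BimoduleIso C (BTensor C (BTensor C X Y) Z) (BTensor C X (BTensor C Y Z)),
      ∀ p : X × Y × Z, Θ.toLinearEquiv (tmul C (tmul C p.1 p.2.1) p.2.2) =
        tmul C p.1 (tmul C p.2.1 p.2.2) := by
  refine exists_of_total _ _ ?_ ?_ (fun p q => ?_) (fun p q => ?_)
  · refine eq_top_iff.2 fun t _ => ?_
    induction t using BTensor.induction with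
    | h0 => exact zero_mem _
    | hadd s t hs ht => exact add_mem (hs trivial) (ht trivial)
    | ht t z =>
    induction t using BTensor.induction with
    | h0 => rw [zero_tmul]; exact zero_mem _
    | hadd s t hs ht => rw [add_tmul]; exact add_mem (hs trivial) (ht trivial)
    | ht x y => exact Submodule.subset_span ⟨(x, y, z), rfl⟩
  · refine eq_top_iff.2 fun t _ => ?_
    induction t using BTensor.induction with
    | h0 => exact zero_mem _
    | hadd s t hs ht => exact add_mem (hs trivial) (ht trivial)
    | ht x t =>
    induction t using BTensor.induction with
    | h0 => rw [tmul_zero]; exact zero_mem _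
    | hadd s t hs ht => rw [tmul_add]; exact add_mem (hs trivial) (ht trivial)
    | ht y z => exact Submodule.subset_span ⟨(x, y, z), rfl⟩
  · simp only [linner_tmul, op_smul_tmul_right]
  · simp only [rinner_tmul, smul_tmul]

end tensor

end BimoduleIso

/-! ### The bimodules `X_α` -/

/-- The underlying set of the bimodule `X_α` of an automorphism `α`, which is `C`. -/
def TwistedBimodule {C : Type u} [CStarAlgebra C] (_α : C ≃⋆ₐ[ℂ] C) : Type u := C

namespace TwistedBimodule

open InnerBimodule

variable {C : Type u} [CStarAlgebra C] [PartialOrder C] [StarOrderedRing C] {α : C ≃⋆ₐ[ℂ] C}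

variable (α) in
/-- An element of `C`, seen in `X_α`. -/
def of (x : C) : TwistedBimodule α := x

/-- An element of `X_α`, seen in `C`. -/
def get (x : TwistedBimodule α) : C := x

instance : AddCommGroup (TwistedBimodule α) := inferInstanceAs (AddCommGroup C)

instance : Module ℂ (TwistedBimodule α) := inferInstanceAs (Module ℂ C)

/-- The left action is multiplication in `C`. -/
instance : Module C (TwistedBimodule α) := inferInstanceAs (Module C C)

/-- The right action is `x · b = x α(b)`. -/
instance : Module Cᵐᵒᵖ (TwistedBimodule α) where
  smul b x := of α (get x * α b.unop)
  one_smul x := show get x * α 1 = get x by rw [map_one, mul_one]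
  mul_smul a b x := show get x * α (b.unop * a.unop) = get x * α b.unop * α a.unop by
    rw [map_mul, mul_assoc]
  smul_zero a := show (0 : C) * α a.unop = 0 by rw [zero_mul]
  smul_add a x y := show (get x + get y) * α a.unop = get x * α a.unop + get y * α a.unop by
    rw [add_mul]
  add_smul a b x := show get x * α (a.unop + b.unop) = get x * α a.unop + get x * α b.unop by
    rw [map_add, mul_add]
  zero_smul x := show get x * α 0 = 0 by rw [map_zero, mul_zero]

instance : InnerBimodule C (TwistedBimodule α) where
  linner x y := get x * star (get y)
  rinner x y := α.symm (star (get x) * get y)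
  algebraMap_smul z x := show algebraMap ℂ C z * get x = z • get x from
    (Algebra.smul_def _ _).symm
  op_algebraMap_smul z x := show get x * α (algebraMap ℂ C z) = z • get x by
    rw [Algebra.algebraMap_eq_smul_one, map_smul, map_one, mul_smul_comm, mul_one]
  smul_op_smul a b x := show a * (get x * α b) = a * get x * α b from (mul_assoc _ _ _).symm
  linner_add x y z := add_mul (get x) (get y) _
  linner_smul a x y := mul_assoc a (get x) _
  star_linner x y := by rw [star_mul, star_star]
  linner_self_nonneg x := mul_star_self_nonneg (get x)
  linner_self_eq_zero x h := CStarRing.mul_star_self_eq_zero_iff _ |>.1 h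
  rinner_add x y z := show α.symm (star (get x) * (get y + get z)) = _ by
    rw [mul_add, map_add]
  rinner_smul b x y := show α.symm (star (get x) * (get y * α b)) = _ by
    rw [← mul_assoc, map_mul, StarAlgEquiv.symm_apply_apply]
  star_rinner x y := by rw [← map_star, star_mul, star_star]
  rinner_self_nonneg x := by
    rw [map_mul, map_star]
    exact star_mul_self_nonneg _
  rinner_self_eq_zero x h := by
    rw [map_mul, map_star] at h
    have h1 := (CStarRing.star_mul_self_eq_zero_iff _).1 h
    rwa [EmbeddingLike.map_eq_zero_iff] at h1
  linner_op_smul b x y := show get x * α b * star (get y) = get x * star (get y * α (star b)) by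
    rw [map_star, star_mul, star_star, mul_assoc]
  rinner_smul_left a x y :=
    show α.symm (star (a * get x) * get y) = α.symm (star (get x) * (star a * get y)) by
      rw [star_mul, mul_assoc]
  linner_smul_eq x y z :=
    show get x * star (get y) * get z = get x * α (α.symm (star (get y) * get z)) by
      rw [StarAlgEquiv.apply_symm_apply, mul_assoc]

lemma linner_of (x y : C) : (linner (of α x) (of α y) : C) = x * star y := rfl

lemma rinner_of (x y : C) : (rinner (of α x) (of α y) : C) = α.symm (star x * y) := rfl

lemma smul_of (c x : C) : c • of α x = of α (c * x) := rfl

lemma op_smul_of (c x : C) : MulOpposite.op c • of α x = of α (x * α c) := rfl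

lemma linner_one : ∑ _i : Unit, (linner (of α 1) (of α 1) : C) = 1 := by simp [linner_of]

lemma rinner_one : ∑ _i : Unit, (rinner (of α 1) (of α 1) : C) = 1 := by simp [rinner_of]

instance : EquivalenceBimodule C (TwistedBimodule α) :=
  EquivalenceBimodule.of_frames linner_one rinner_one

end TwistedBimodule

namespace BimoduleIso

open InnerBimodule BTensor

variable {C : Type u} {X : Type*} [CStarAlgebra C] [PartialOrder C] [StarOrderedRing C]
  [AddCommGroup X] [Module ℂ X] [Module C X] [Module Cᵐᵒᵖ X] [InnerBimodule C X]
  [EquivalenceBimodule C X]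

open TwistedBimodule in
/-- `X_α ⊗ X_β ≅ X_{αβ}`. -/
lemma exists_twisted (α β : C ≃⋆ₐ[ℂ] C) :
    ∃ Θ : BimoduleIso C (BTensor C (TwistedBimodule α) (TwistedBimodule β))
      (TwistedBimodule (α * β)), ∀ p : C × C,
      Θ.toLinearEquiv (tmul C (of α p.1) (of β p.2)) = of (α * β) (p.1 * α p.2) := by
  refine exists_of_total (fun p : C × C => tmul C (of α p.1) (of β p.2))
    (fun p => of (α * β) (p.1 * α p.2))
    (span_tmul (X := TwistedBimodule α) (Y := TwistedBimodule β)) ?_ (fun p q => ?_) (fun p q => ?_)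
  · refine eq_top_iff.2 fun t _ => Submodule.subset_span ⟨(get t, 1), ?_⟩
    change get t * α 1 = t
    rw [map_one, mul_one]; rfl
  · rw [linner_tmul, linner_of, linner_of, op_smul_of, linner_of, map_mul, map_star, star_mul]
    simp only [mul_assoc]
  · rw [rinner_tmul, rinner_of, rinner_of, smul_of, rinner_of]
    change _ = β.symm (α.symm _)
    congr 1
    simp only [map_mul, map_star, star_mul, StarAlgEquiv.symm_apply_apply, mul_assoc]

open TwistedBimodule in
variable (C X) in
/-- `C ⊗ X ≅ X`. -/
lemma exists_one_tensor :
    ∃ Θ : BimoduleIso C (BTensor C (TwistedBimodule (1 : C ≃⋆ₐ[ℂ] C)) X) X, ∀ p : C × X,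
      Θ.toLinearEquiv (tmul C (of 1 p.1) p.2) = p.1 • p.2 := by
  refine exists_of_total (fun p : C × X => tmul C (of 1 p.1) p.2)
    (fun p => p.1 • p.2)
    (span_tmul (X := TwistedBimodule (1 : C ≃⋆ₐ[ℂ] C)) (Y := X)) ?_ (fun p q => ?_) (fun p q => ?_)
  · refine eq_top_iff.2 fun t _ => Submodule.subset_span ⟨(1, t), one_smul _ _⟩
  · rw [linner_tmul, op_smul_of, linner_of, linner_smul, linner_smul_right, mul_assoc]
    rfl
  · rw [rinner_tmul, rinner_of, rinner_smul_left, smul_smul]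
    rfl

variable (C X) in
/-- `X̃ ⊗ X ≅ C`. -/
lemma exists_dual_tensor :
    ∃ Θ : BimoduleIso C (BTensor C (DualBimodule X) X) (TwistedBimodule (1 : C ≃⋆ₐ[ℂ] C)),
      ∀ p : X × X, Θ.toLinearEquiv (tmul C (DualBimodule.mk p.1) p.2) =
        TwistedBimodule.of 1 (rinner p.1 p.2) := by
  refine exists_of_total (fun p : X × X => tmul C (DualBimodule.mk p.1) p.2)
    (fun p => TwistedBimodule.of 1 (rinner p.1 p.2))
    (span_tmul (X := DualBimodule X) (Y := X)) ?_ (fun p q => ?_) (fun p q => ?_)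
  · refine eq_top_iff.2 fun t _ => ?_
    obtain ⟨ι, _, v, hv⟩ := EquivalenceBimodule.exists_right_frame C X
    exact mem_span_of_frame_right hv (TwistedBimodule.get t) _ fun i => ⟨(_, _), rfl⟩
  · rw [linner_tmul, TwistedBimodule.linner_of]
    change (rinner (star (linner p.2 q.2 : C) • p.1) q.1 : C) = _
    rw [star_linner, linner_smul_eq, rinner_op_smul_left, star_rinner, star_rinner]
  · rw [rinner_tmul, TwistedBimodule.rinner_of]
    change (rinner p.2 ((linner p.1 q.1 : C) • q.2) : C) = star (rinner p.1 p.2) * rinner q.1 q.2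
    rw [linner_smul_eq, rinner_smul, star_rinner]

/-- An isomorphism induces one of the duals. -/
def dual {Y : Type*} [AddCommGroup Y] [Module ℂ Y] [Module C Y] [Module Cᵐᵒᵖ Y]
    [InnerBimodule C Y] (Φ : BimoduleIso C X Y) :
    BimoduleIso C (DualBimodule X) (DualBimodule Y) where
  toLinearEquiv :=
    { toFun := fun x => DualBimodule.mk (Φ.toLinearEquiv x.get)
      invFun := fun x => DualBimodule.mk (Φ.toLinearEquiv.symm x.get)
      map_add' := fun x y => map_add Φ.toLinearEquiv x.get y.get
      map_smul' := fun z x => map_smul Φ.toLinearEquiv (star z) x.get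
      left_inv := fun x => Φ.toLinearEquiv.symm_apply_apply x.get
      right_inv := fun x => Φ.toLinearEquiv.apply_symm_apply x.get }
  map_smul_left c x := Φ.map_smul_right (star c) x.get
  map_smul_right c x := Φ.map_smul_left (star c) x.get
  map_linner x y := Φ.map_rinner x.get y.get
  map_rinner x y := Φ.map_linner x.get y.get

end BimoduleIso

/-! ### The Picard group of a unital `C⋆`-algebra -/

/-- A `C`-`C`-equivalence bimodule, bundled. -/
structure EquivBimod (C : Type u) [CStarAlgebra C] [PartialOrder C] [StarOrderedRing C] where
  carrier : Type u
  [addCommGroup : AddCommGroup carrier]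
  [moduleComplex : Module ℂ carrier]
  [moduleLeft : Module C carrier]
  [moduleRight : Module Cᵐᵒᵖ carrier]
  [innerBimodule : InnerBimodule C carrier]
  [equivalenceBimodule : EquivalenceBimodule C carrier]

namespace EquivBimod

attribute [instance] addCommGroup moduleComplex moduleLeft moduleRight innerBimodule
  equivalenceBimodule

variable {C : Type u} [CStarAlgebra C] [PartialOrder C] [StarOrderedRing C]

/-- The tensor product `X ⊗_C Y`. -/
abbrev tensor (X Y : EquivBimod C) : EquivBimod C := ⟨BTensor C X.carrier Y.carrier⟩

/-- The dual bimodule. -/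
abbrev dual (X : EquivBimod C) : EquivBimod C := ⟨DualBimodule X.carrier⟩

/-- The bimodule `X_α`; the one of the identity is `C` itself. -/
abbrev twisted (α : C ≃⋆ₐ[ℂ] C) : EquivBimod C := ⟨TwistedBimodule α⟩

variable (C) in
/-- Isomorphism of equivalence bimodules. -/
instance setoid : Setoid (EquivBimod C) where
  r X Y := Nonempty (BimoduleIso C X.carrier Y.carrier)
  iseqv :=
    { refl := fun X => ⟨BimoduleIso.refl C X.carrier⟩
      symm := fun ⟨Φ⟩ => ⟨Φ.symm⟩
      trans := fun ⟨Φ⟩ ⟨Ψ⟩ => ⟨Φ.trans Ψ⟩ }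

end EquivBimod

/-- The Picard group of a unital `C⋆`-algebra `C`: isomorphism classes of `C`-`C`-equivalence
bimodules with the relative tensor product as multiplication. -/
def Pic (C : Type u) [CStarAlgebra C] [PartialOrder C] [StarOrderedRing C] : Type (u + 1) :=
  Quotient (EquivBimod.setoid C)

namespace Pic

variable {C : Type u} [CStarAlgebra C] [PartialOrder C] [StarOrderedRing C]

/-- The class `[X]`. -/
def mk (X : EquivBimod C) : Pic C := Quotient.mk (EquivBimod.setoid C) X

instance : Mul (Pic C) where
  mul := Quotient.map₂ EquivBimod.tensor fun _ _ ⟨Φ⟩ _ _ ⟨Ψ⟩ =>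
    let ⟨Θ, _⟩ := BimoduleIso.exists_congr Φ Ψ
    ⟨Θ⟩

instance : One (Pic C) where
  one := mk (EquivBimod.twisted 1)

instance : Inv (Pic C) where
  inv := Quotient.map EquivBimod.dual fun _ _ ⟨Φ⟩ => ⟨Φ.dual⟩

instance : Group (Pic C) :=
  Group.ofLeftAxioms
    (by
      rintro ⟨X⟩ ⟨Y⟩ ⟨Z⟩
      obtain ⟨Θ, _⟩ := BimoduleIso.exists_assoc C X.carrier Y.carrier Z.carrier
      exact Quotient.sound ⟨Θ⟩)
    (by
      rintro ⟨X⟩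
      obtain ⟨Θ, _⟩ := BimoduleIso.exists_one_tensor C X.carrier
      exact Quotient.sound ⟨Θ⟩)
    (by
      rintro ⟨X⟩
      obtain ⟨Θ, _⟩ := BimoduleIso.exists_dual_tensor C X.carrier
      exact Quotient.sound ⟨Θ⟩)

variable (C) in
/-- The homomorphism `α ↦ [X_α]` from `Aut(C)` to `Pic(C)`. -/
def ofAut : (C ≃⋆ₐ[ℂ] C) →* Pic C where
  toFun α := mk (EquivBimod.twisted α)
  map_one' := rfl
  map_mul' α β := by
    obtain ⟨Θ, _⟩ := BimoduleIso.exists_twisted α β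
    exact (Quotient.sound ⟨Θ⟩ : mk ((EquivBimod.twisted α).tensor (EquivBimod.twisted β)) =
      mk (EquivBimod.twisted (α * β))).symm

end Pic

/-! ### The Picard group of a unital inclusion -/

/-- The conditions under which a closed subspace `V` of the `C`-`C`-equivalence bimodule `X`
implements a strong Morita equivalence of the unital inclusion `S ⊆ C` with itself. -/
structure IsEquiPair {C : Type u} {X : Type v} [CStarAlgebra C] [PartialOrder C]
    [StarOrderedRing C] [AddCommGroup X] [Module ℂ X] [Module C X] [Module Cᵐᵒᵖ X]
    [InnerBimodule C X] (S : StarSubalgebra ℂ C) (V : Submodule ℂ X) : Prop where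
  isClosed : IsClosed[InnerBimodule.topology C X] (V : Set X)
  smul_mem : ∀ a ∈ S, ∀ x ∈ V, a • x ∈ V
  linner_mem : ∀ x ∈ V, ∀ y ∈ V, InnerBimodule.linner x y ∈ S
  closure_linner : closure (Submodule.span ℂ
    {c : C | ∃ x ∈ V, ∃ y ∈ V, c = InnerBimodule.linner x y} : Set C) = S
  closure_linner_univ : closure (Submodule.span ℂ
    {c : C | ∃ y : X, ∃ x ∈ V, c = InnerBimodule.linner y x} : Set C) = Set.univ
  op_smul_mem : ∀ a ∈ S, ∀ x ∈ V, MulOpposite.op a • x ∈ V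
  rinner_mem : ∀ x ∈ V, ∀ y ∈ V, InnerBimodule.rinner x y ∈ S
  closure_rinner : closure (Submodule.span ℂ
    {c : C | ∃ x ∈ V, ∃ y ∈ V, c = InnerBimodule.rinner x y} : Set C) = S
  closure_rinner_univ : closure (Submodule.span ℂ
    {c : C | ∃ y : X, ∃ x ∈ V, c = InnerBimodule.rinner y x} : Set C) = Set.univ

/-- The submodule `V` of the dual bimodule. -/
def DualBimodule.submodule {X : Type v} [AddCommGroup X] [Module ℂ X] (V : Submodule ℂ X) :
    Submodule ℂ (DualBimodule X) where
  carrier := {x | x.get ∈ V}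
  add_mem' := fun hx hy => V.add_mem hx hy
  zero_mem' := V.zero_mem
  smul_mem' := fun z _ hx => V.smul_mem (star z) hx

/-- The subspace `X_α = A` of `Y_α = C`. -/
def TwistedBimodule.submodule {C : Type u} [CStarAlgebra C] {α : C ≃⋆ₐ[ℂ] C}
    (A : StarSubalgebra ℂ C) : Submodule ℂ (TwistedBimodule α) where
  carrier := {x | x.get ∈ A}
  add_mem' := fun hx hy => add_mem (S := StarSubalgebra ℂ C) hx hy
  zero_mem' := zero_mem A
  smul_mem' := fun z _ hx => SMulMemClass.smul_mem (S := StarSubalgebra ℂ C) (M := C) z hx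

/-- The span of the tensors `x ⊗ y` with `x ∈ V` and `y ∈ W`. Under the hypotheses of
`IsEquiPair.tensor` it is closed in `X ⊗_C Y`. -/
def BTensor.submodule (C : Type u) {X : Type v} {Y : Type w} [CStarAlgebra C] [PartialOrder C]
    [AddCommGroup X] [Module ℂ X] [Module C X] [Module Cᵐᵒᵖ X]
    [AddCommGroup Y] [Module ℂ Y] [Module C Y] [Module Cᵐᵒᵖ Y]
    (V : Submodule ℂ X) (W : Submodule ℂ Y) : Submodule ℂ (BTensor C X Y) :=
  Submodule.span ℂ {t | ∃ x ∈ V, ∃ y ∈ W, t = BTensor.tmul C x y}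

namespace IsEquiPair

open InnerBimodule

variable {C : Type u} {X : Type v} [CStarAlgebra C] [PartialOrder C] [StarOrderedRing C]
  [AddCommGroup X] [Module ℂ X] [Module C X] [Module Cᵐᵒᵖ X] [InnerBimodule C X]
  {Y : Type w} [AddCommGroup Y] [Module ℂ Y] [Module C Y] [Module Cᵐᵒᵖ Y] [InnerBimodule C Y]
  {S : StarSubalgebra ℂ C} {V : Submodule ℂ X} {W : Submodule ℂ Y}

lemma exists_left_frame [hS : IsClosed (S : Set C)] (h : IsEquiPair S V) :
    ∃ (ι : Type) (_ : Fintype ι) (w : ι → X), (∀ i, w i ∈ V) ∧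
      ∑ i, (linner (w i) (w i) : C) = 1 := by
  refine exists_frame S V h.smul_mem h.linner_mem ?_
  have : (1 : C) ∈ (S : Set C) := one_mem S
  rwa [← h.closure_linner] at this

lemma exists_right_frame [hS : IsClosed (S : Set C)] (h : IsEquiPair S V) :
    ∃ (ι : Type) (_ : Fintype ι) (v : ι → X), (∀ i, v i ∈ V) ∧
      ∑ i, (rinner (v i) (v i) : C) = 1 := by
  refine exists_frame (X := DualBimodule X) S (DualBimodule.submodule V)
    (fun a ha x hx => h.op_smul_mem _ (star_mem ha) _ hx) h.rinner_mem ?_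
  have : (1 : C) ∈ (S : Set C) := one_mem S
  rwa [← h.closure_rinner] at this

lemma of_frames [hS : IsClosed (S : Set C)] (h1 : ∀ a ∈ S, ∀ x ∈ V, a • x ∈ V)
    (h2 : ∀ x ∈ V, ∀ y ∈ V, linner x y ∈ S)
    (h3 : ∀ a ∈ S, ∀ x ∈ V, MulOpposite.op a • x ∈ V) (h4 : ∀ x ∈ V, ∀ y ∈ V, rinner x y ∈ S)
    {ι κ : Type*} [Fintype ι] [Fintype κ] {w : ι → X} {v : κ → X} (hwV : ∀ i, w i ∈ V)
    (hvV : ∀ i, v i ∈ V) (hw : ∑ i, (linner (w i) (w i) : C) = 1)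
    (hv : ∑ i, (rinner (v i) (v i) : C) = 1) : IsEquiPair S V where
  isClosed := isClosed_of_frame S V h1 h2 hvV hv
  smul_mem := h1
  linner_mem := h2
  closure_linner := by
    refine Set.Subset.antisymm (closure_minimal ?_ hS) fun c hc => subset_closure <|
      mem_span_of_frame hw c _ fun i => ⟨_, h1 c hc _ (hwV i), _, hwV i, rfl⟩
    refine Submodule.span_le (p := Subalgebra.toSubmodule S.toSubalgebra).2 ?_
    rintro _ ⟨x, hx, y, hy, rfl⟩
    exact h2 x hx y hy
  closure_linner_univ := Set.eq_univ_of_forall fun c => subset_closure <|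
    mem_span_of_frame hw c _ fun i => ⟨_, _, hwV i, rfl⟩
  op_smul_mem := h3
  rinner_mem := h4
  closure_rinner := by
    refine Set.Subset.antisymm (closure_minimal ?_ hS) fun c hc => subset_closure <|
      mem_span_of_frame_right hv c _ fun i => ⟨_, h3 _ (star_mem hc) _ (hvV i), _, hvV i, rfl⟩
    refine Submodule.span_le (p := Subalgebra.toSubmodule S.toSubalgebra).2 ?_
    rintro _ ⟨x, hx, y, hy, rfl⟩
    exact h4 x hx y hy
  closure_rinner_univ := Set.eq_univ_of_forall fun c => subset_closure <|
    mem_span_of_frame_right hv c _ fun i => ⟨_, _, hvV i, rfl⟩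

lemma dual [hS : IsClosed (S : Set C)] (h : IsEquiPair S V) :
    IsEquiPair S (DualBimodule.submodule V) := by
  obtain ⟨ι, _, w, hwV, hw⟩ := h.exists_left_frame
  obtain ⟨κ, _, v, hvV, hv⟩ := h.exists_right_frame
  exact of_frames (X := DualBimodule X) (w := v) (v := w)
    (fun a ha x hx => h.op_smul_mem _ (star_mem ha) _ hx) h.rinner_mem
    (fun a ha x hx => h.smul_mem _ (star_mem ha) _ hx) h.linner_mem hvV hwV hv hw

section tensor

variable [EquivalenceBimodule C X] [EquivalenceBimodule C Y]

open BTensor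

lemma tensor [hS : IsClosed (S : Set C)] (hV : IsEquiPair S V) (hW : IsEquiPair S W) :
    IsEquiPair S (BTensor.submodule C V W) := by
  obtain ⟨_, _, w, hwV, hw⟩ := hV.exists_left_frame
  obtain ⟨_, _, w', hwW, hw'⟩ := hW.exists_left_frame
  obtain ⟨_, _, v, hvV, hv⟩ := hV.exists_right_frame
  obtain ⟨_, _, v', hvW, hv'⟩ := hW.exists_right_frame
  refine of_frames ?_ ?_ ?_ ?_ ?_ ?_ (sum_linner_frame hw hw') (sum_rinner_frame hv hv')
  · intro a ha t ht
    induction ht using Submodule.span_induction with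
    | zero => rw [smul_zero]; exact zero_mem _
    | add s t _ _ hs ht => rw [smul_add]; exact add_mem hs ht
    | smul z t _ ht => rw [smul_csmul]; exact Submodule.smul_mem _ _ ht
    | mem t ht =>
      obtain ⟨x, hx, y, hy, rfl⟩ := ht
      exact Submodule.subset_span ⟨_, hV.smul_mem a ha x hx, y, hy, rfl⟩
  · intro s hs t ht
    induction hs using Submodule.span_induction with
    | zero => rw [linner_zero]; exact zero_mem _
    | add s s' _ _ hs hs' => rw [linner_add]; exact add_mem hs hs'
    | smul z s _ hs => rw [linner_csmul]; exact SMulMemClass.smul_mem _ hs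
    | mem s hs =>
    obtain ⟨x, hx, y, hy, rfl⟩ := hs
    induction ht using Submodule.span_induction with
    | zero => rw [linner_zero_right]; exact zero_mem _
    | add s s' _ _ hs hs' => rw [linner_add_right]; exact add_mem hs hs'
    | smul z s _ hs => rw [linner_csmul_right]; exact SMulMemClass.smul_mem _ hs
    | mem s hs =>
    obtain ⟨x', hx', y', hy', rfl⟩ := hs
    rw [linner_tmul]
    exact hV.linner_mem _ (hV.op_smul_mem _ (hW.linner_mem _ hy _ hy') _ hx) _ hx'
  · intro a ha t ht
    induction ht using Submodule.span_induction with
    | zero => rw [smul_zero]; exact zero_mem _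
    | add s t _ _ hs ht => rw [smul_add]; exact add_mem hs ht
    | smul z t _ ht => rw [op_smul_csmul]; exact Submodule.smul_mem _ _ ht
    | mem t ht =>
      obtain ⟨x, hx, y, hy, rfl⟩ := ht
      exact Submodule.subset_span ⟨x, hx, _, hW.op_smul_mem a ha y hy, rfl⟩
  · intro s hs t ht
    induction hs using Submodule.span_induction with
    | zero => rw [rinner_zero_left]; exact zero_mem _
    | add s s' _ _ hs hs' => rw [rinner_add_left]; exact add_mem hs hs'
    | smul z s _ hs => rw [rinner_csmul_left]; exact SMulMemClass.smul_mem _ hs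
    | mem s hs =>
    obtain ⟨x, hx, y, hy, rfl⟩ := hs
    induction ht using Submodule.span_induction with
    | zero => rw [rinner_zero]; exact zero_mem _
    | add s s' _ _ hs hs' => rw [rinner_add]; exact add_mem hs hs'
    | smul z s _ hs => rw [rinner_csmul]; exact SMulMemClass.smul_mem _ hs
    | mem s hs =>
    obtain ⟨x', hx', y', hy', rfl⟩ := hs
    rw [rinner_tmul]
    exact hW.rinner_mem _ hy _ (hW.smul_mem _ (hV.rinner_mem _ hx _ hx') _ hy')
  · exact fun p => Submodule.subset_span ⟨_, hwV _, _, hwW _, rfl⟩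
  · exact fun p => Submodule.subset_span ⟨_, hvV _, _, hvW _, rfl⟩

end tensor

end IsEquiPair

/-- The group `Aut(A, C)` of the automorphisms of `C` that restrict to an automorphism of the
subalgebra `A`. -/
def autPair {C : Type u} [CStarAlgebra C] (A : StarSubalgebra ℂ C) :
    Subgroup (C ≃⋆ₐ[ℂ] C) where
  carrier := {α | ∀ c, α c ∈ A ↔ c ∈ A}
  mul_mem' := fun {α β} hα hβ c => (hα (β c)).trans (hβ c)
  one_mem' := fun _ => Iff.rfl
  inv_mem' := fun {α} hα c => by
    rw [← hα]
    exact iff_of_eq (congrArg (· ∈ A) (α.apply_symm_apply c))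

/-- The group `Aut₀(A, C)` of the automorphisms of `C` that fix `A` pointwise. -/
def autFixing {C : Type u} [CStarAlgebra C] (A : StarSubalgebra ℂ C) :
    Subgroup (C ≃⋆ₐ[ℂ] C) where
  carrier := {α | ∀ a ∈ A, α a = a}
  mul_mem' := fun {α β} hα hβ a ha => (congrArg α (hβ a ha)).trans (hα a ha)
  one_mem' := fun _ _ => rfl
  inv_mem' := fun {α} hα a ha => by
    conv_lhs => rw [← hα a ha]
    exact α.symm_apply_apply a

lemma autFixing_le_autPair {C : Type u} [CStarAlgebra C] (A : StarSubalgebra ℂ C) :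
    autFixing A ≤ autPair A := fun α hα c => by
  refine ⟨fun h => ?_, fun h => ?_⟩
  · have h1 : α c = c := α.injective (hα _ h)
    rwa [h1] at h
  · rwa [hα c h]

/-- The elements `(X, Y)` of `Equi(A, C)`: a `C`-`C`-equivalence bimodule `Y` and a closed subspace
`X` of it. -/
structure EquiPair {C : Type u} [CStarAlgebra C] [PartialOrder C] [StarOrderedRing C]
    (A : StarSubalgebra ℂ C) where
  bimod : EquivBimod C
  sub : Submodule ℂ bimod.carrier
  isEquiPair : IsEquiPair A sub

namespace EquiPair

variable {C : Type u} [CStarAlgebra C] [PartialOrder C] [StarOrderedRing C]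
  (A : StarSubalgebra ℂ C)

/-- `(X, Y) ∼ (Z, W)` if there is an isomorphism `Φ : Y ≅ W` of `C`-`C`-equivalence bimodules with
`Φ(X) = Z`; the restriction of `Φ` to `X` is then an isomorphism of `A`-`A`-equivalence
bimodules, as the actions and inner products on `X` and `Z` are restricted from `Y` and `W`. -/
instance setoid : Setoid (EquiPair A) where
  r P Q := ∃ Φ : BimoduleIso C P.bimod.carrier Q.bimod.carrier,
    P.sub.map (Φ.toLinearEquiv : P.bimod.carrier →ₗ[ℂ] Q.bimod.carrier) = Q.sub
  iseqv :=
    { refl := fun P => ⟨BimoduleIso.refl C P.bimod.carrier, Submodule.map_id _⟩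
      symm := fun {P Q} ⟨Φ, h⟩ => ⟨Φ.symm, by
        rw [← h]
        ext x
        simp [BimoduleIso.symm]⟩
      trans := fun {P Q R} ⟨Φ, h⟩ ⟨Ψ, h'⟩ => ⟨Φ.trans Ψ, by
        rw [← h', ← h, ← Submodule.map_comp]
        rfl⟩ }

variable {A} [hA : IsClosed (A : Set C)]

/-- The pair `(X ⊗_A Z, Y ⊗_C W)`, where `X ⊗_A Z` is realised inside `Y ⊗_C W`. -/
def tensor (P Q : EquiPair A) : EquiPair A :=
  ⟨⟨BTensor C P.bimod.carrier Q.bimod.carrier⟩, BTensor.submodule C P.sub Q.sub,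
    P.isEquiPair.tensor Q.isEquiPair⟩

/-- The pair `(X̃, Ỹ)`. -/
def dual (P : EquiPair A) : EquiPair A :=
  ⟨⟨DualBimodule P.bimod.carrier⟩,
    (DualBimodule.submodule P.sub : Submodule ℂ (DualBimodule P.bimod.carrier)),
    P.isEquiPair.dual⟩

/-- The pair `(X_α, Y_α)` of an automorphism; the one of the identity is `(A, C)` itself. -/
def twisted (α : autPair A) : EquiPair A where
  bimod := ⟨TwistedBimodule (α : C ≃⋆ₐ[ℂ] C)⟩
  sub := (TwistedBimodule.submodule A : Submodule ℂ (TwistedBimodule (α : C ≃⋆ₐ[ℂ] C)))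
  isEquiPair := by
    refine IsEquiPair.of_frames (X := TwistedBimodule (α : C ≃⋆ₐ[ℂ] C)) ?_ ?_ ?_ ?_
      (w := fun _ : Unit => TwistedBimodule.of _ 1) (v := fun _ : Unit => TwistedBimodule.of _ 1)
      (fun _ => one_mem A) (fun _ => one_mem A) TwistedBimodule.linner_one
      TwistedBimodule.rinner_one
    · exact fun a ha x hx => mul_mem (S := StarSubalgebra ℂ C) ha hx
    · exact fun x hx y hy => mul_mem (S := StarSubalgebra ℂ C) hx (star_mem hy)
    · exact fun a ha x hx => mul_mem (S := StarSubalgebra ℂ C) hx ((α.2 a).2 ha)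
    · intro x hx y hy
      refine (α.2 _).1 ?_
      change (α : C ≃⋆ₐ[ℂ] C) ((α : C ≃⋆ₐ[ℂ] C).symm _) ∈ A
      rw [StarAlgEquiv.apply_symm_apply]
      exact mul_mem (S := StarSubalgebra ℂ C) (star_mem hx) hy

end EquiPair

/-- The Picard group `Pic(A, C)` of a unital inclusion of unital `C⋆`-algebras `A ⊆ C`, where `A` is
a closed unital `⋆`-subalgebra of `C`. -/
def PicPair {C : Type u} [CStarAlgebra C] [PartialOrder C] [StarOrderedRing C]
    (A : StarSubalgebra ℂ C) : Type (u + 1) :=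
  Quotient (EquiPair.setoid A)

namespace PicPair

variable {C : Type u} [CStarAlgebra C] [PartialOrder C] [StarOrderedRing C]
  {A : StarSubalgebra ℂ C}

/-- The class `[X, Y]`. -/
def mk (P : EquiPair A) : PicPair A := Quotient.mk (EquiPair.setoid A) P

lemma map_span_eq {X : Type v} {Y : Type w} [AddCommGroup X] [Module ℂ X] [AddCommGroup Y]
    [Module ℂ Y] {T : Type*} (Φ : X ≃ₗ[ℂ] Y) (f : T → X) (g : T → Y) (h : ∀ t, Φ (f t) = g t)
    (s : Set T) : (Submodule.span ℂ (f '' s)).map (Φ : X →ₗ[ℂ] Y) = Submodule.span ℂ (g '' s) := by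
  rw [Submodule.map_span, Set.image_image]
  congr 1
  exact Set.image_congr fun t _ => h t

variable [hA : IsClosed (A : Set C)]

open BTensor

lemma submodule_eq {X : Type v} {Y : Type w}
    [AddCommGroup X] [Module ℂ X] [Module C X] [Module Cᵐᵒᵖ X]
    [AddCommGroup Y] [Module ℂ Y] [Module C Y] [Module Cᵐᵒᵖ Y]
    (V : Submodule ℂ X) (W : Submodule ℂ Y) :
    BTensor.submodule C V W = Submodule.span ℂ
      ((fun p : X × Y => tmul C p.1 p.2) '' {p | p.1 ∈ V ∧ p.2 ∈ W}) := by
  rw [BTensor.submodule]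
  congr 1
  ext t
  constructor
  · rintro ⟨x, hx, y, hy, rfl⟩
    exact ⟨(x, y), ⟨hx, hy⟩, rfl⟩
  · rintro ⟨p, ⟨hx, hy⟩, rfl⟩
    exact ⟨_, hx, _, hy, rfl⟩

lemma tensor_congr {P P' Q Q' : EquiPair A} (h : P ≈ P') (h' : Q ≈ Q') :
    P.tensor Q ≈ P'.tensor Q' := by
  obtain ⟨Φ, hΦ⟩ := h
  obtain ⟨Ψ, hΨ⟩ := h'
  obtain ⟨Θ, hΘ⟩ := BimoduleIso.exists_congr Φ Ψ
  refine ⟨Θ, ?_⟩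
  change (BTensor.submodule C P.sub Q.sub).map
    (Θ.toLinearEquiv : _ →ₗ[ℂ] _) = BTensor.submodule C P'.sub Q'.sub
  rw [submodule_eq, map_span_eq Θ.toLinearEquiv _ _ hΘ, ← hΦ, ← hΨ, BTensor.submodule]
  congr 1
  ext t
  constructor
  · rintro ⟨p, ⟨hx, hy⟩, rfl⟩
    exact ⟨_, ⟨_, hx, rfl⟩, _, ⟨_, hy, rfl⟩, rfl⟩
  · rintro ⟨_, ⟨x, hx, rfl⟩, _, ⟨y, hy, rfl⟩, rfl⟩
    exact ⟨(x, y), ⟨hx, hy⟩, rfl⟩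

lemma dual_congr {P P' : EquiPair A} (h : P ≈ P') : P.dual ≈ P'.dual := by
  obtain ⟨Φ, hΦ⟩ := h
  refine ⟨Φ.dual, ?_⟩
  change (DualBimodule.submodule P.sub).map (Φ.dual.toLinearEquiv : _ →ₗ[ℂ] _) =
    DualBimodule.submodule P'.sub
  rw [← hΦ]
  ext x
  constructor
  · rintro ⟨y, hy, rfl⟩
    exact ⟨y, hy, rfl⟩
  · rintro ⟨y, hy, rfl⟩
    exact ⟨y, hy, rfl⟩

lemma tensor_assoc (P Q R : EquiPair A) : (P.tensor Q).tensor R ≈ P.tensor (Q.tensor R) := by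
  obtain ⟨Θ, hΘ⟩ := BimoduleIso.exists_assoc C P.bimod.carrier Q.bimod.carrier R.bimod.carrier
  refine ⟨Θ, ?_⟩
  change (BTensor.submodule C (BTensor.submodule C P.sub Q.sub) R.sub).map
    (Θ.toLinearEquiv : _ →ₗ[ℂ] _) =
    BTensor.submodule C P.sub (BTensor.submodule C Q.sub R.sub)
  have h1 : BTensor.submodule C (BTensor.submodule C P.sub Q.sub) R.sub = Submodule.span ℂ
      ((fun p : P.bimod.carrier × Q.bimod.carrier × R.bimod.carrier =>
        tmul C (tmul C p.1 p.2.1) p.2.2) '' {p | p.1 ∈ P.sub ∧ p.2.1 ∈ Q.sub ∧ p.2.2 ∈ R.sub}) := by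
    refine le_antisymm (Submodule.span_le.2 ?_) (Submodule.span_le.2 ?_)
    · rintro _ ⟨t, ht, z, hz, rfl⟩
      induction ht using Submodule.span_induction with
      | zero => rw [zero_tmul]; exact zero_mem _
      | add s t _ _ hs ht => rw [add_tmul]; exact add_mem hs ht
      | smul c t _ ht => rw [csmul_tmul]; exact Submodule.smul_mem _ _ ht
      | mem t ht =>
        obtain ⟨x, hx, y, hy, rfl⟩ := ht
        exact Submodule.subset_span ⟨(x, y, z), ⟨hx, hy, hz⟩, rfl⟩
    · rintro _ ⟨p, ⟨hx, hy, hz⟩, rfl⟩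
      exact Submodule.subset_span ⟨_, Submodule.subset_span ⟨_, hx, _, hy, rfl⟩, _, hz, rfl⟩
  have h2 : BTensor.submodule C P.sub (BTensor.submodule C Q.sub R.sub) = Submodule.span ℂ
      ((fun p : P.bimod.carrier × Q.bimod.carrier × R.bimod.carrier =>
        tmul C p.1 (tmul C p.2.1 p.2.2)) '' {p | p.1 ∈ P.sub ∧ p.2.1 ∈ Q.sub ∧ p.2.2 ∈ R.sub}) := by
    refine le_antisymm (Submodule.span_le.2 ?_) (Submodule.span_le.2 ?_)
    · rintro _ ⟨x, hx, t, ht, rfl⟩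
      induction ht using Submodule.span_induction with
      | zero => rw [tmul_zero]; exact zero_mem _
      | add s t _ _ hs ht => rw [tmul_add]; exact add_mem hs ht
      | smul c t _ ht => rw [tmul_csmul]; exact Submodule.smul_mem _ _ ht
      | mem t ht =>
        obtain ⟨y, hy, z, hz, rfl⟩ := ht
        exact Submodule.subset_span ⟨(x, y, z), ⟨hx, hy, hz⟩, rfl⟩
    · rintro _ ⟨p, ⟨hx, hy, hz⟩, rfl⟩
      exact Submodule.subset_span ⟨_, hx, _, Submodule.subset_span ⟨_, hy, _, hz, rfl⟩, rfl⟩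
  rw [h1, h2]
  exact map_span_eq Θ.toLinearEquiv _ _ hΘ _

lemma twisted_tensor (α β : autPair A) :
    (EquiPair.twisted α).tensor (EquiPair.twisted β) ≈ EquiPair.twisted (α * β) := by
  obtain ⟨Θ, hΘ⟩ := BimoduleIso.exists_twisted (α : C ≃⋆ₐ[ℂ] C) (β : C ≃⋆ₐ[ℂ] C)
  refine ⟨Θ, ?_⟩
  change (BTensor.submodule C (TwistedBimodule.submodule (α := (α : C ≃⋆ₐ[ℂ] C)) A)
    (TwistedBimodule.submodule (α := (β : C ≃⋆ₐ[ℂ] C)) A)).map (Θ.toLinearEquiv : _ →ₗ[ℂ] _) =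
    TwistedBimodule.submodule (α := (α * β : C ≃⋆ₐ[ℂ] C)) A
  rw [submodule_eq]
  refine (map_span_eq Θ.toLinearEquiv _ _ hΘ _).trans ?_
  refine le_antisymm (Submodule.span_le.2 ?_) fun x hx => ?_
  · rintro _ ⟨p, ⟨hx, hy⟩, rfl⟩
    exact mul_mem (S := StarSubalgebra ℂ C) hx ((α.2 _).2 hy)
  · refine Submodule.subset_span ⟨(x.get, 1), ⟨hx, one_mem A⟩, ?_⟩
    change x.get * (α : C ≃⋆ₐ[ℂ] C) 1 = x
    rw [map_one, mul_one]; rfl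

lemma one_tensor (P : EquiPair A) : (EquiPair.twisted 1).tensor P ≈ P := by
  obtain ⟨Θ, hΘ⟩ := BimoduleIso.exists_one_tensor C P.bimod.carrier
  refine ⟨Θ, ?_⟩
  change (BTensor.submodule C (TwistedBimodule.submodule (α := (1 : C ≃⋆ₐ[ℂ] C)) A) P.sub).map
    (Θ.toLinearEquiv : _ →ₗ[ℂ] _) = P.sub
  rw [submodule_eq]
  refine (map_span_eq Θ.toLinearEquiv _ _ hΘ _).trans ?_
  refine le_antisymm (Submodule.span_le.2 ?_) fun x hx => ?_
  · rintro _ ⟨p, ⟨hx, hy⟩, rfl⟩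
    exact P.isEquiPair.smul_mem _ hx _ hy
  · exact Submodule.subset_span ⟨(1, x), ⟨one_mem A, hx⟩, one_smul _ _⟩

lemma dual_tensor (P : EquiPair A) : P.dual.tensor P ≈ EquiPair.twisted 1 := by
  obtain ⟨Θ, hΘ⟩ := BimoduleIso.exists_dual_tensor C P.bimod.carrier
  refine ⟨Θ, ?_⟩
  change (BTensor.submodule C (DualBimodule.submodule P.sub) P.sub).map
    (Θ.toLinearEquiv : _ →ₗ[ℂ] _) =
    TwistedBimodule.submodule (α := (1 : C ≃⋆ₐ[ℂ] C)) A
  rw [submodule_eq]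
  refine (map_span_eq Θ.toLinearEquiv _ _ hΘ _).trans ?_
  refine le_antisymm (Submodule.span_le.2 ?_) fun x hx => ?_
  · rintro _ ⟨p, ⟨hx, hy⟩, rfl⟩
    exact P.isEquiPair.rinner_mem _ hx _ hy
  · obtain ⟨ι, _, v, hvV, hv⟩ := P.isEquiPair.exists_right_frame
    exact InnerBimodule.mem_span_of_frame_right hv x.get _ fun i =>
      ⟨(_, _), ⟨P.isEquiPair.op_smul_mem _ (star_mem hx) _ (hvV i), hvV i⟩, rfl⟩

instance : Mul (PicPair A) where
  mul := Quotient.map₂ EquiPair.tensor fun _ _ h _ _ h' => tensor_congr h h'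

instance : One (PicPair A) where
  one := mk (EquiPair.twisted 1)

instance : Inv (PicPair A) where
  inv := Quotient.map EquiPair.dual fun _ _ h => dual_congr h

instance : Group (PicPair A) :=
  Group.ofLeftAxioms
    (by
      rintro ⟨P⟩ ⟨Q⟩ ⟨R⟩
      exact Quotient.sound (tensor_assoc P Q R))
    (by
      rintro ⟨P⟩
      exact Quotient.sound (one_tensor P))
    (by
      rintro ⟨P⟩
      exact Quotient.sound (dual_tensor P))

variable (A) in
/-- The homomorphism `α ↦ [X_α, Y_α]` from `Aut(A, C)` to `Pic(A, C)`. -/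
def ofAut : autPair A →* PicPair A where
  toFun α := mk (EquiPair.twisted α)
  map_one' := rfl
  map_mul' α β := (Quotient.sound (twisted_tensor α β) :
    mk ((EquiPair.twisted α).tensor (EquiPair.twisted β)) = mk (EquiPair.twisted (α * β))).symm

end PicPair

/-! ### The inclusion `A ⊆ M_n(A)` -/

section matrix

variable (A : Type u) [CStarAlgebra A] [PartialOrder A] [StarOrderedRing A] (n : ℕ)

/-- The unital `⋆`-homomorphism `a ↦ a ⊗ I_n` from `A` to `M_n(A)`. -/
def scalarHom : A →⋆ₐ[ℂ] CStarMatrix (Fin n) (Fin n) A where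
  toFun a := CStarMatrix.ofMatrix (Matrix.diagonal fun _ => a)
  map_one' := Matrix.diagonal_one
  map_mul' a b := (Matrix.diagonal_mul_diagonal (fun _ : Fin n => a) (fun _ => b)).symm
  map_zero' := Matrix.diagonal_zero
  map_add' a b := (Matrix.diagonal_add (fun _ : Fin n => a) (fun _ => b)).symm
  commutes' _ := rfl
  map_star' a := (Matrix.diagonal_conjTranspose (fun _ : Fin n => a)).symm

/-- The subalgebra `A ⊗ I_n` of `M_n(A)`. -/
def scalarMatrices : StarSubalgebra ℂ (CStarMatrix (Fin n) (Fin n) A) := (scalarHom A n).range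

lemma mem_scalarMatrices {M : CStarMatrix (Fin n) (Fin n) A} :
    M ∈ scalarMatrices A n ↔ (∀ i j, i ≠ j → M i j = 0) ∧ ∀ i j, M i i = M j j := by
  constructor
  · rintro ⟨a, rfl⟩
    exact ⟨fun i j h => Matrix.diagonal_apply_ne _ h,
      fun i j => (Matrix.diagonal_apply_eq (fun _ : Fin n => a) i).trans
        (Matrix.diagonal_apply_eq (fun _ : Fin n => a) j).symm⟩
  · rintro ⟨h1, h2⟩
    rcases isEmpty_or_nonempty (Fin n) with h | ⟨⟨k⟩⟩
    · exact ⟨0, by ext i; exact isEmptyElim i⟩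
    · refine ⟨M k k, ?_⟩
      ext i j
      rcases eq_or_ne i j with rfl | hij
      · exact (Matrix.diagonal_apply_eq _ i).trans (h2 k i)
      · exact (Matrix.diagonal_apply_ne _ hij).trans (h1 i j hij).symm

instance isClosed_scalarMatrices :
    IsClosed (scalarMatrices A n : Set (CStarMatrix (Fin n) (Fin n) A)) := by
  have hc : ∀ i j, Continuous fun M : CStarMatrix (Fin n) (Fin n) A => M i j := fun i j =>
    (continuous_apply j).comp (continuous_apply (A := fun _ : Fin n => Fin n → A) i)
  have : (scalarMatrices A n : Set (CStarMatrix (Fin n) (Fin n) A)) =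
      {M | (∀ i j, i ≠ j → M i j = 0) ∧ ∀ i j, M i i = M j j} :=
    Set.ext fun M => mem_scalarMatrices A n
  rw [this]
  simp only [Set.ofPred_and, Set.ofPred_forall]
  exact (isClosed_iInter fun i => isClosed_iInter fun j => isClosed_iInter fun _ =>
    isClosed_eq (hc i j) continuous_const).inter
    (isClosed_iInter fun i => isClosed_iInter fun j => isClosed_eq (hc i i) (hc j j))

variable {A}

/-- The automorphism `α ⊗ id` of `M_n(A)`. -/
def matrixAut (α : A ≃⋆ₐ[ℂ] A) :
    CStarMatrix (Fin n) (Fin n) A ≃⋆ₐ[ℂ] CStarMatrix (Fin n) (Fin n) A where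
  toFun M := M.map α
  invFun M := M.map α.symm
  left_inv M := by ext; simp
  right_inv M := by ext; simp
  map_mul' M N := by
    ext
    simp [CStarMatrix.mul_apply]
  map_add' M N := by ext; simp
  map_star' M := by ext; simp [CStarMatrix.star_apply, map_star]
  map_smul' z M := by ext; simp

lemma matrixAut_mem (α : A ≃⋆ₐ[ℂ] A) : matrixAut n α ∈ autPair (scalarMatrices A n) := by
  intro M
  rw [mem_scalarMatrices, mem_scalarMatrices]
  have h : ∀ i j, matrixAut n α M i j = α (M i j) := fun _ _ => rfl
  simp only [h, EmbeddingLike.map_eq_zero_iff, EmbeddingLike.apply_eq_iff_eq]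

end matrix

end

/-! Write `C` for `M_n(A)` and identify `A` with `A ⊗ I_n`. Three facts about `π : Aut(A, C) →
Pic(A, C)` carry the proof.

Surjectivity (`PicPair.ofAut_surjective`). In a pair `(X, Y)` the space `X` is itself an
`A`-`A`-equivalence bimodule, because its inner products take values in `A` and are full there. As
`Aut(A) → Pic(A)` is onto, `X ≅ X_α` for some `α`, and the vector that corresponds to `1` is an `x₀
∈ X` with `⟨x₀, x₀⟩ = 1` on both sides. The inclusion `A ⊆ C` is unital, so `x₀` is just as well a
unitary generator of `Y`. Comparing the two actions on it gives `γ ∈ Aut(C)` with `x₀ · c = γ(c) ·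
x₀`. Then `Y ≅ Y_γ`, and since `x₀` lies in `X`, the automorphism `γ` preserves `A` and `X`
corresponds to `A`. The only place where the hypothesis on `Pic(A)` enters this argument is the
existence of `x₀`.

Kernel (`PicPair.ofAut_eq_one_iff`, `PicPair.ofAut_scalarMatrices_eq_one_iff`). An isomorphism from
`(A, C)` to `(X_γ, Y_γ)` is determined by the image of `1`, which is a unitary of `A`; hence the
kernel of `π` consists of the `Ad(u)` with `u ∈ A` unitary. For `u = a ⊗ I_n` this is `Ad(a) ⊗ id`,
so the kernel is `Int(A) ⊗ id`.

Splitting (`exists_restrict`, `eq_of_apply_eq_scalarHom`). Each `γ ∈ Aut(A, C)` restricts to some `α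
∈ Aut(A)`, and `γ (α ⊗ id)⁻¹` fixes `A` pointwise, while `α ⊗ id` fixes `A` pointwise only for `α =
1`. So `Aut(A, C)` is a semidirect product of `Aut₀(A, C)` by `Aut(A)`. The kernel of `π` sits in
the second factor as `Int(A)`. Dividing by it leaves `Aut₀(A, C)` intact and turns `Aut(A)` into
`Aut(A) / Int(A) = Pic(A)`. -/

/-! ### Semidirect products inside a group -/

/-- A group that is generated by the injective images of `N` and `B`, the first one normal and
meeting the second one trivially, is a semidirect product of `N` by `B`. -/
lemma SemidirectProduct.exists_mulEquiv {N B Q : Type*} [Group N] [Group B] [Group Q]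
    (f : N →* Q) (s : B →* Q) (hf : Function.Injective f) [hn : f.range.Normal]
    (hs : ∀ b, s b ∈ f.range → b = 1) (hfs : ∀ q, ∃ x b, q = f x * s b) :
    ∃ (φ : B →* MulAut N) (e : N ⋊[φ] B ≃* Q),
      (∀ x, e (SemidirectProduct.inl x) = f x) ∧ ∀ b, e (SemidirectProduct.inr b) = s b := by
  let j : N ≃* f.range := f.ofInjective hf
  -- The action is conjugation by `s b` on the normal subgroup `f.range`, transported to `N` along
  -- `j`. The formula `hφ` is the compatibility that `SemidirectProduct.lift` asks for.
  let φ : B →* MulAut N :=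
    (MulAut.congr j.symm).toMonoidHom.comp ((MulAut.conjNormal (H := f.range)).comp s)
  have hφ : ∀ b x, f (φ b x) = s b * f x * (s b)⁻¹ := by
    intro b x
    have h1 : j (φ b x) = MulAut.conjNormal (s b) (j x) := j.apply_symm_apply _
    exact (congrArg Subtype.val h1).trans (MulAut.conjNormal_apply (s b) (j x))
  let F : N ⋊[φ] B →* Q := SemidirectProduct.lift f s fun b => by
    ext x
    exact hφ b x
  have hF : ∀ t, F t = f t.left * s t.right := fun _ => rfl
  refine ⟨φ, MulEquiv.ofBijective F ⟨(injective_iff_map_eq_one F).2 fun t ht => ?_, fun q => ?_⟩,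
    fun x => ?_, fun b => ?_⟩
  · rw [hF] at ht
    -- From `f x * s b = 1` it follows that `s b = f x⁻¹` lies in the range of `f`, so the trivial
    -- intersection forces `b = 1`.
    have h1 : t.right = 1 := hs _ ⟨t.left⁻¹, by rw [map_inv, inv_eq_of_mul_eq_one_right ht]⟩
    rw [h1, map_one, mul_one] at ht
    exact SemidirectProduct.ext (hf (ht.trans (map_one f).symm)) h1
  · obtain ⟨x, b, rfl⟩ := hfs q
    exact ⟨⟨x, b⟩, hF _⟩
  · exact (hF _).trans (by simp)
  · exact (hF _).trans (by simp)

/-! ### Bimodules with a unitary generator -/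

namespace InnerBimodule

variable {C : Type u} {X : Type v} [CStarAlgebra C] [PartialOrder C]
  [AddCommGroup X] [Module ℂ X] [Module C X] [Module Cᵐᵒᵖ X] [InnerBimodule C X] {x₀ : X}

/-- The relation `⟨y, x₀⟩ · x₀ = y · ⟨x₀, x₀⟩` turns the normalisation of one inner product into a
reconstruction formula for the action on the other side. Together with the next lemma it makes `x₀`
a generator for both actions. -/
lemma linner_smul_generator (hr : (rinner x₀ x₀ : C) = 1) (y : X) :
    (linner y x₀ : C) • x₀ = y := by
  rw [linner_smul_eq, hr, MulOpposite.op_one, one_smul]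

lemma op_rinner_smul_generator (hl : (linner x₀ x₀ : C) = 1) (y : X) :
    MulOpposite.op (rinner x₀ y : C) • x₀ = y := by
  rw [← linner_smul_eq, hl, one_smul]

/-- A vector `x₀` with `⟨x₀, x₀⟩ = 1` for both inner products determines the automorphism `γ` with
`x₀ · c = γ(c) · x₀`. -/
def generatorAut (hl : (linner x₀ x₀ : C) = 1) (hr : (rinner x₀ x₀ : C) = 1) : C ≃⋆ₐ[ℂ] C where
  toFun c := linner (MulOpposite.op c • x₀) x₀
  invFun c := rinner x₀ (c • x₀)
  left_inv c := by
    beta_reduce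
    rw [linner_smul_generator hr, rinner_smul, hr, one_mul]
  right_inv c := by
    beta_reduce
    rw [op_rinner_smul_generator hl, linner_smul, hl, mul_one]
  -- Multiplicativity comes from `γ(c) · (x₀ · d) = (x₀ · c) · ⟨x₀, x₀ · d⟩ = x₀ · (c d)`, where the
  -- first equality is the compatibility of the two inner products.
  map_mul' c d := by
    rw [← linner_smul, linner_smul_eq, rinner_smul, hr, one_mul, smul_smul,
      ← MulOpposite.op_mul]
  map_add' c d := by rw [MulOpposite.op_add, add_smul, linner_add]
  map_star' c := by rw [star_linner, linner_op_smul, star_star]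
  map_smul' z c := by rw [op_csmul_smul, linner_csmul]

lemma generatorAut_symm_apply (hl : (linner x₀ x₀ : C) = 1) (hr : (rinner x₀ x₀ : C) = 1) (c : C) :
    (generatorAut hl hr).symm c = rinner x₀ (c • x₀) := rfl

/-- A bimodule with a unitary generator is a twisted bimodule. -/
lemma exists_iso_twisted [StarOrderedRing C] (hl : (linner x₀ x₀ : C) = 1)
    (hr : (rinner x₀ x₀ : C) = 1) :
    ∃ Φ : BimoduleIso C X (TwistedBimodule (generatorAut hl hr)), ∀ c : C,
      Φ.toLinearEquiv (c • x₀) = TwistedBimodule.of _ c := by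
  -- Both bimodules are spanned by families indexed by `C`, so only the inner products have to be
  -- compared. On the right, `⟨c · x₀, d · x₀⟩ = ⟨x₀, c⋆d · x₀⟩ = γ⁻¹(c⋆d)`, which is the right
  -- inner product of `X_γ`.
  refine BimoduleIso.exists_of_total (fun c : C => c • x₀) (fun c => TwistedBimodule.of _ c)
    ?_ ?_ (fun c d => ?_) (fun c d => ?_)
  · exact eq_top_iff.2 fun y _ => Submodule.subset_span ⟨_, linner_smul_generator hr y⟩
  · exact eq_top_iff.2 fun y _ => Submodule.subset_span ⟨TwistedBimodule.get y, rfl⟩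
  · rw [linner_smul, linner_smul_right, hl, one_mul, TwistedBimodule.linner_of]
  · rw [TwistedBimodule.rinner_of, generatorAut_symm_apply, rinner_smul_left, smul_smul]

end InnerBimodule

/-! ### Image and kernel of `Aut(A, C) → Pic(A, C)`. -/

namespace PicPair

open InnerBimodule

variable {C : Type u} [CStarAlgebra C] [PartialOrder C] [StarOrderedRing C]
  {A : StarSubalgebra ℂ C} [hA : IsClosed (A : Set C)]

/-- A pair with a unitary generator in the subspace comes from an automorphism. -/
lemma mk_mem_range_ofAut (P : EquiPair A) {x₀ : P.bimod.carrier} (hx : x₀ ∈ P.sub)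
    (hl : (linner x₀ x₀ : C) = 1) (hr : (rinner x₀ x₀ : C) = 1) :
    ∃ γ, ofAut A γ = mk P := by
  have hP := P.isEquiPair
  -- Both `γ(c)` and `γ⁻¹(c)` are inner products of vectors of `X` when `c ∈ A`, because `x₀ ∈ X`.
  -- Both inclusions are needed for `γ` to restrict to an automorphism of `A`.
  have h1 : ∀ c ∈ A, generatorAut hl hr c ∈ A := fun c hc =>
    hP.linner_mem _ (hP.op_smul_mem c hc _ hx) _ hx
  have h2 : ∀ c ∈ A, (generatorAut hl hr).symm c ∈ A := fun c hc =>
    hP.rinner_mem _ hx _ (hP.smul_mem c hc _ hx)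
  obtain ⟨Φ, hΦ⟩ := exists_iso_twisted hl hr
  let γ : autPair A := ⟨generatorAut hl hr, fun c => ⟨fun h => by
    rw [← (generatorAut hl hr).symm_apply_apply c]
    exact h2 _ h, h1 c⟩⟩
  refine ⟨γ, (Quotient.sound (show P ≈ EquiPair.twisted γ from ⟨Φ, ?_⟩)).symm⟩
  · refine le_antisymm ?_ fun y hy => ?_
    -- Written as `y = ⟨y, x₀⟩ · x₀`, a vector of `X` has its coefficient in `A`; conversely `a · x₀
    -- ∈ X` for `a ∈ A`. So `X` corresponds exactly to `A`.
    · rintro _ ⟨y, hy, rfl⟩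
      rw [← linner_smul_generator hr y]
      have h3 : (linner y x₀ : C) ∈ A := hP.linner_mem _ hy _ hx
      exact (hΦ (linner y x₀)).symm ▸ h3
    · exact ⟨TwistedBimodule.get (α := generatorAut hl hr) y • x₀, hP.smul_mem _ hy _ hx, hΦ _⟩

/-- The kernel of `Aut(A, C) → Pic(A, C)`. -/
lemma ofAut_eq_one_iff {γ : autPair A} :
    ofAut A γ = 1 ↔ ∃ u : unitary C, (u : C) ∈ A ∧
      (γ : C ≃⋆ₐ[ℂ] C) = Unitary.conjStarAlgAut ℂ C u := by
  constructor
  · intro h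
    obtain ⟨Φ, hΦ⟩ : ∃ Φ : BimoduleIso C (TwistedBimodule (1 : C ≃⋆ₐ[ℂ] C))
        (TwistedBimodule (γ : C ≃⋆ₐ[ℂ] C)),
        (TwistedBimodule.submodule (α := (1 : C ≃⋆ₐ[ℂ] C)) A).map (Φ.toLinearEquiv :
          TwistedBimodule (1 : C ≃⋆ₐ[ℂ] C) →ₗ[ℂ] TwistedBimodule (γ : C ≃⋆ₐ[ℂ] C)) =
        TwistedBimodule.submodule A := Quotient.exact h.symm
    -- The image `v` of `1` carries all the information: `Φ(A) = A` puts it into `A`, and the two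
    -- inner products make it unitary.
    set v : C := TwistedBimodule.get (Φ.toLinearEquiv (TwistedBimodule.of 1 (1 : C))) with hv
    have hmem : v ∈ A := by
      have h1 : Φ.toLinearEquiv (TwistedBimodule.of 1 (1 : C)) ∈
          TwistedBimodule.submodule (α := (γ : C ≃⋆ₐ[ℂ] C)) A := by
        rw [← hΦ]
        exact ⟨TwistedBimodule.of 1 1, one_mem A, rfl⟩
      exact h1
    have hl : v * star v = 1 :=
      (Φ.map_linner (TwistedBimodule.of 1 1) (TwistedBimodule.of 1 1)).trans <| by
        rw [TwistedBimodule.linner_of, star_one, mul_one]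
    have hr : star v * v = 1 := by
      have h1 : (γ : C ≃⋆ₐ[ℂ] C).symm (star v * v) = 1 :=
        (Φ.map_rinner (TwistedBimodule.of 1 1) (TwistedBimodule.of 1 1)).trans <| by
          rw [TwistedBimodule.rinner_of, star_one, mul_one, map_one]
      rw [← (γ : C ≃⋆ₐ[ℂ] C).apply_symm_apply (star v * v), h1, map_one]
    -- In the untwisted bimodule `c · 1 = 1 · c`. The image of the left side is `c v`, that of the
    -- right side is `v γ(c)`.
    have hc : ∀ c, c * v = v * (γ : C ≃⋆ₐ[ℂ] C) c := fun c => by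
      have h1 := Φ.map_smul_left c (TwistedBimodule.of 1 1)
      have h2 := Φ.map_smul_right c (TwistedBimodule.of 1 1)
      rw [TwistedBimodule.smul_of, mul_one] at h1
      rw [TwistedBimodule.op_smul_of, one_mul, StarAlgEquiv.one_apply] at h2
      exact h1.symm.trans h2
    -- Since `γ(c) = v⋆ c v`, the implementing unitary is `v⋆` and not `v`.
    refine ⟨⟨star v, ?_⟩, star_mem hmem, ?_⟩
    · exact Unitary.star_mem (Unitary.mem_iff.2 ⟨hr, hl⟩)
    · ext c
      change _ = star v * c * star (star v)
      rw [star_star, mul_assoc, hc, ← mul_assoc, hr, one_mul]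
  · rintro ⟨u, hu, hγ⟩
    have hu1 : star (u : C) * u = 1 := Unitary.coe_star_mul_self u
    have hu2 : (u : C) * star (u : C) = 1 := Unitary.coe_mul_star_self u
    -- Right multiplication by `u` is an isomorphism from `Y_γ` to `C`: the left inner product
    -- survives because `u u⋆ = 1`, the right one because `γ⁻¹ = Ad(u⋆)`.
    obtain ⟨Φ, hΦ⟩ := BimoduleIso.exists_of_total (C := C)
      (fun c : C => TwistedBimodule.of (γ : C ≃⋆ₐ[ℂ] C) c)
      (fun c => TwistedBimodule.of 1 (c * u))
      (eq_top_iff.2 fun y _ => Submodule.subset_span ⟨TwistedBimodule.get y, rfl⟩)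
      (eq_top_iff.2 fun y _ => Submodule.subset_span ⟨TwistedBimodule.get y * star (u : C), by
        change _ * _ * _ = TwistedBimodule.get y
        rw [mul_assoc, hu1, mul_one]⟩)
      (fun c d => by
        rw [TwistedBimodule.linner_of, TwistedBimodule.linner_of, star_mul, mul_assoc,
          ← mul_assoc (u : C), hu2, one_mul])
      (fun c d => by
        rw [TwistedBimodule.rinner_of, TwistedBimodule.rinner_of, hγ,
          Unitary.conjStarAlgAut_symm_apply, star_mul]
        change _ = star (u : C) * star c * (d * u)
        simp only [mul_assoc])
    refine Quotient.sound (show EquiPair.twisted γ ≈ EquiPair.twisted 1 from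
      ⟨Φ, le_antisymm ?_ fun y hy => ?_⟩)
    · rintro _ ⟨y, hy, rfl⟩
      have h1 : TwistedBimodule.get (α := (γ : C ≃⋆ₐ[ℂ] C)) y * u ∈ A :=
        mul_mem (S := StarSubalgebra ℂ C) hy hu
      exact (hΦ y).symm ▸ h1
    -- The inverse is right multiplication by `u⋆`, which also preserves `A` since `u ∈ A`.
    · refine ⟨TwistedBimodule.of (γ : C ≃⋆ₐ[ℂ] C)
        (TwistedBimodule.get (α := (1 : C ≃⋆ₐ[ℂ] C)) y * star (u : C)),
        mul_mem (S := StarSubalgebra ℂ C) hy (star_mem hu), (hΦ _).trans ?_⟩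
      rw [mul_assoc, hu1, mul_one]
      rfl

end PicPair

/-! ### The bimodule over the smaller algebra -/

/-- The subspace `V` of an element `(V, X)` of `Equi(j(A), C)`, where `j : A → C` is an injective
unital `⋆`-homomorphism; it is an `A`-`A`-equivalence bimodule. -/
def RestrictedBimodule {A : Type u} {C : Type v} {X : Type w} [CStarAlgebra A] [CStarAlgebra C]
    [PartialOrder C] [StarOrderedRing C] [AddCommGroup X] [Module ℂ X] [Module C X] [Module Cᵐᵒᵖ X]
    [InnerBimodule C X] {j : A →⋆ₐ[ℂ] C} {V : Submodule ℂ X} (_hj : Function.Injective j)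
    (_h : IsEquiPair j.range V) : Type w := V

/-- An element with positive image under an injective unital `⋆`-homomorphism is positive. -/
lemma StarAlgHom.nonneg_of_map_nonneg {A : Type u} {C : Type v} [CStarAlgebra A] [PartialOrder A]
    [StarOrderedRing A] [CStarAlgebra C] [PartialOrder C] [StarOrderedRing C] {j : A →⋆ₐ[ℂ] C}
    (hj : Function.Injective j) [hc : IsClosed (j.range : Set C)] {a : A} (ha : 0 ≤ j a) :
    0 ≤ a := by
  -- The continuous functional calculus does not leave a closed unital `⋆`-subalgebra, so the square
  -- root of `j a` has a preimage `b`, and injectivity of `j` gives `a = b⋆b`.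
  obtain ⟨b, hb⟩ : cfc Real.sqrt (j a) ∈ j.range := cfc_mem (𝕜' := ℂ) _ ⟨a, rfl⟩
  have h1 : star (cfc Real.sqrt (j a)) = cfc Real.sqrt (j a) :=
    (cfc_predicate (R := ℝ) (p := IsSelfAdjoint) _ (j a) : IsSelfAdjoint _)
  have h2 : cfc Real.sqrt (j a) * cfc Real.sqrt (j a) = j a := by
    rw [← cfc_mul Real.sqrt Real.sqrt (j a)]
    exact (cfc_congr fun t ht => Real.mul_self_sqrt (spectrum_nonneg_of_nonneg ha ht)).trans
      (cfc_id' ℝ (j a) ha.isSelfAdjoint)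
  have h3 : a = star b * b := hj <| by
    rw [map_mul, map_star]
    have h4 : j b = cfc Real.sqrt (j a) := hb
    rw [h4, h1, h2]
  rw [h3]
  exact star_mul_self_nonneg b

namespace RestrictedBimodule

open InnerBimodule

variable {A : Type u} {C : Type v} {X : Type w} [CStarAlgebra A] [CStarAlgebra C]
  [PartialOrder C] [StarOrderedRing C] [AddCommGroup X] [Module ℂ X] [Module C X] [Module Cᵐᵒᵖ X]
  [InnerBimodule C X] {j : A →⋆ₐ[ℂ] C} {V : Submodule ℂ X} {hj : Function.Injective j}
  {h : IsEquiPair j.range V}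

/-- The underlying vector of `X`. -/
def get (x : RestrictedBimodule hj h) : X := Subtype.val (p := (· ∈ V)) x

lemma get_mem (x : RestrictedBimodule hj h) : x.get ∈ V := Subtype.property (p := (· ∈ V)) x

lemma ext {x y : RestrictedBimodule hj h} (e : x.get = y.get) : x = y := Subtype.ext e

instance : AddCommGroup (RestrictedBimodule hj h) := inferInstanceAs (AddCommGroup V)

instance : Module ℂ (RestrictedBimodule hj h) := inferInstanceAs (Module ℂ V)

/-- The actions of `A` are those of `C` through `j`, and `h` keeps them inside `V`. Carrying `hj`
and `h` as arguments of the type makes them available to instance search. -/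
instance : Module A (RestrictedBimodule hj h) where
  smul a x := ⟨j a • x.get, h.smul_mem _ ⟨a, rfl⟩ _ x.get_mem⟩
  one_smul x := ext <| show j 1 • x.get = x.get by rw [map_one, one_smul]
  mul_smul a b x := ext <| show j (a * b) • x.get = j a • j b • x.get by rw [map_mul, mul_smul]
  smul_zero a := ext (smul_zero (j a))
  smul_add a x y := ext (smul_add (j a) x.get y.get)
  add_smul a b x := ext <| show j (a + b) • x.get = j a • x.get + j b • x.get by
    rw [map_add, add_smul]
  zero_smul x := ext <| show j 0 • x.get = 0 by rw [map_zero, zero_smul]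

instance : Module Aᵐᵒᵖ (RestrictedBimodule hj h) where
  smul a x := ⟨MulOpposite.op (j a.unop) • x.get, h.op_smul_mem _ ⟨a.unop, rfl⟩ _ x.get_mem⟩
  one_smul x := ext <| show MulOpposite.op (j 1) • x.get = x.get by
    rw [map_one, MulOpposite.op_one, one_smul]
  mul_smul a b x := ext <| show MulOpposite.op (j (b.unop * a.unop)) • x.get =
      MulOpposite.op (j a.unop) • MulOpposite.op (j b.unop) • x.get by
    rw [map_mul, MulOpposite.op_mul, mul_smul]
  smul_zero a := ext (smul_zero (MulOpposite.op (j a.unop)))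
  smul_add a x y := ext (smul_add (MulOpposite.op (j a.unop)) x.get y.get)
  add_smul a b x := ext <| show MulOpposite.op (j (a.unop + b.unop)) • x.get =
      MulOpposite.op (j a.unop) • x.get + MulOpposite.op (j b.unop) • x.get by
    rw [map_add, MulOpposite.op_add, add_smul]
  zero_smul x := ext <| show MulOpposite.op (j 0) • x.get = 0 by
    rw [map_zero, MulOpposite.op_zero, zero_smul]

lemma exists_map_eq_linner (x y : RestrictedBimodule hj h) :
    ∃ a, j a = linner x.get y.get :=
  (h.linner_mem _ x.get_mem _ y.get_mem)

lemma exists_map_eq_rinner (x y : RestrictedBimodule hj h) :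
    ∃ a, j a = rinner x.get y.get :=
  (h.rinner_mem _ x.get_mem _ y.get_mem)

variable [PartialOrder A] [StarOrderedRing A] [hc : IsClosed (j.range : Set C)]

/-- The inner products are the preimages under `j` of those of `X`, so each identity between
elements of `A` can be checked in `C` after applying the injective `j`. Only positivity needs more,
namely that it is reflected by `j`. -/
noncomputable instance : InnerBimodule A (RestrictedBimodule hj h) where
  linner x y := (exists_map_eq_linner x y).choose
  rinner x y := (exists_map_eq_rinner x y).choose
  algebraMap_smul z x := ext <| show j (algebraMap ℂ A z) • x.get = z • x.get by
    rw [AlgHomClass.commutes, InnerBimodule.algebraMap_smul]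
  op_algebraMap_smul z x := ext <|
    show MulOpposite.op (j (algebraMap ℂ A z)) • x.get = z • x.get by
      rw [AlgHomClass.commutes, InnerBimodule.op_algebraMap_smul]
  smul_op_smul a b x := ext (smul_op_smul (j a) (j b) x.get)
  linner_add x y z := hj <| by
    rw [map_add]
    simp only [(exists_map_eq_linner _ _).choose_spec]
    exact linner_add _ _ _
  linner_smul a x y := hj <| by
    rw [map_mul]
    simp only [(exists_map_eq_linner _ _).choose_spec]
    exact linner_smul _ _ _
  star_linner x y := hj <| by
    rw [map_star]
    simp only [(exists_map_eq_linner _ _).choose_spec]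
    exact star_linner _ _
  linner_self_nonneg x := StarAlgHom.nonneg_of_map_nonneg hj <| by
    rw [(exists_map_eq_linner _ _).choose_spec]
    exact linner_self_nonneg _
  linner_self_eq_zero x hx := ext <| linner_self_eq_zero (C := C) _ <| by
    rw [← (exists_map_eq_linner _ _).choose_spec, hx, map_zero]
  rinner_add x y z := hj <| by
    rw [map_add]
    simp only [(exists_map_eq_rinner _ _).choose_spec]
    exact rinner_add _ _ _
  rinner_smul a x y := hj <| by
    rw [map_mul]
    simp only [(exists_map_eq_rinner _ _).choose_spec]
    exact rinner_smul _ _ _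
  star_rinner x y := hj <| by
    rw [map_star]
    simp only [(exists_map_eq_rinner _ _).choose_spec]
    exact star_rinner _ _
  rinner_self_nonneg x := StarAlgHom.nonneg_of_map_nonneg hj <| by
    rw [(exists_map_eq_rinner _ _).choose_spec]
    exact rinner_self_nonneg _
  rinner_self_eq_zero x hx := ext <| rinner_self_eq_zero (C := C) _ <| by
    rw [← (exists_map_eq_rinner _ _).choose_spec, hx, map_zero]
  linner_op_smul b x y := hj <| by
    simp only [(exists_map_eq_linner _ _).choose_spec]
    refine (linner_op_smul (j b) x.get y.get).trans ?_
    rw [← map_star]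
    rfl
  rinner_smul_left a x y := hj <| by
    simp only [(exists_map_eq_rinner _ _).choose_spec]
    refine (rinner_smul_left (j a) x.get y.get).trans ?_
    rw [← map_star]
    rfl
  linner_smul_eq x y z := ext <| by
    change j (exists_map_eq_linner x y).choose • z.get =
      MulOpposite.op (j (exists_map_eq_rinner y z).choose) • x.get
    rw [(exists_map_eq_linner _ _).choose_spec, (exists_map_eq_rinner _ _).choose_spec,
      linner_smul_eq]

lemma map_linner (x y : RestrictedBimodule hj h) : j (linner x y) = linner x.get y.get :=
  (exists_map_eq_linner x y).choose_spec

lemma map_rinner (x y : RestrictedBimodule hj h) : j (rinner x y) = rinner x.get y.get :=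
  (exists_map_eq_rinner x y).choose_spec

/-- The fullness conditions of an equivalence pair provide finite frames of vectors of `V`, whose
sums of inner products are `1` in `C`, hence also in `A`. Such frames yield fullness over `A` and
completeness at the same time. -/
instance : EquivalenceBimodule A (RestrictedBimodule hj h) := by
  obtain ⟨ι, _, w, hwV, hw⟩ := h.exists_left_frame
  obtain ⟨κ, _, v, hvV, hv⟩ := h.exists_right_frame
  refine EquivalenceBimodule.of_frames (X := RestrictedBimodule hj h)
    (w := fun i => ⟨w i, hwV i⟩) (v := fun i => ⟨v i, hvV i⟩) (hj ?_) (hj ?_)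
  · rw [map_sum, map_one, ← hw]
    exact Finset.sum_congr rfl fun i _ => map_linner _ _
  · rw [map_sum, map_one, ← hv]
    exact Finset.sum_congr rfl fun i _ => map_rinner _ _

end RestrictedBimodule

/-! ### Surjectivity of `Aut(A, C) → Pic(A, C)`. -/

namespace PicPair

open InnerBimodule

/-- If every class in `Pic(A)` comes from an automorphism of `A`, then every class in `Pic(A, C)`
comes from an automorphism of the pair. -/
lemma ofAut_surjective {A C : Type u} [CStarAlgebra A] [PartialOrder A] [StarOrderedRing A]
    [CStarAlgebra C] [PartialOrder C] [StarOrderedRing C] {j : A →⋆ₐ[ℂ] C}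
    (hj : Function.Injective j) [hc : IsClosed (j.range : Set C)]
    (hsurj : Function.Surjective (Pic.ofAut A)) : Function.Surjective (ofAut j.range) := by
  rintro ⟨P⟩
  obtain ⟨α, hα⟩ := hsurj (Pic.mk ⟨RestrictedBimodule hj P.isEquiPair⟩)
  obtain ⟨Φ⟩ : Nonempty (BimoduleIso A (TwistedBimodule α) (RestrictedBimodule hj P.isEquiPair)) :=
    Quotient.exact hα
  -- The vector `1` of `X_α` has both inner products equal to `1`. Its image in the subspace of `P`
  -- inherits this over `A`, and then over `C` because `j` is unital.
  refine mk_mem_range_ofAut P (Φ.toLinearEquiv (TwistedBimodule.of α 1)).get_mem ?_ ?_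
  · rw [← RestrictedBimodule.map_linner, Φ.map_linner, TwistedBimodule.linner_of, star_one, mul_one,
      map_one]
  · rw [← RestrictedBimodule.map_rinner, Φ.map_rinner, TwistedBimodule.rinner_of, star_one, mul_one,
      map_one, map_one]

end PicPair

/-! ### Automorphisms of the inclusion `A ⊆ M_n(A)` -/

section matrix

variable {A : Type u} [CStarAlgebra A] [PartialOrder A] [StarOrderedRing A] {n : ℕ}

lemma scalarHom_apply_same (a : A) (i : Fin n) : scalarHom A n a i i = a :=
  Matrix.diagonal_apply_eq _ i

lemma scalarHom_injective [NeZero n] : Function.Injective (scalarHom A n) := fun a b h => by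
  rw [← scalarHom_apply_same a (0 : Fin n), h, scalarHom_apply_same]

lemma matrixAut_scalarHom (α : A ≃⋆ₐ[ℂ] A) (a : A) :
    matrixAut n α (scalarHom A n a) = scalarHom A n (α a) :=
  Matrix.diagonal_map (map_zero α)

lemma scalarHom_mul_apply (a : A) (M : CStarMatrix (Fin n) (Fin n) A) (i k : Fin n) :
    (scalarHom A n a * M) i k = a * M i k :=
  Matrix.diagonal_mul _ _ _ _

lemma mul_scalarHom_apply (a : A) (M : CStarMatrix (Fin n) (Fin n) A) (i k : Fin n) :
    (M * scalarHom A n a) i k = M i k * a :=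
  Matrix.mul_diagonal _ _ _ _

/-- This is `Ad(u ⊗ I_n) = Ad(u) ⊗ id` in entries; through it the kernel of `Aut(A, M_n(A)) → Pic(A,
M_n(A))` is expressed by inner automorphisms of `A`. -/
lemma conj_scalarHom (u : A) (M : CStarMatrix (Fin n) (Fin n) A) (i k : Fin n) :
    (scalarHom A n u * M * star (scalarHom A n u)) i k = u * M i k * star u := by
  rw [← map_star, mul_scalarHom_apply, scalarHom_mul_apply]

/-- The automorphism `α ⊗ id` is trivial in `Pic(A, M_n(A))` when `α` is inner, and these are the
only such automorphisms of the inclusion. -/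
lemma PicPair.ofAut_scalarMatrices_eq_one_iff [NeZero n] {γ : autPair (scalarMatrices A n)} :
    PicPair.ofAut (scalarMatrices A n) γ = 1 ↔ ∃ u : unitary A,
      (γ : CStarMatrix (Fin n) (Fin n) A ≃⋆ₐ[ℂ] CStarMatrix (Fin n) (Fin n) A) =
        matrixAut n (Unitary.conjStarAlgAut ℂ A u) := by
  rw [PicPair.ofAut_eq_one_iff]
  constructor
  -- A unitary of `M_n(A)` that lies in `A ⊗ I_n` has the form `a ⊗ I_n`, and `a` is itself unitary
  -- because `scalarHom` is injective.
  · rintro ⟨⟨_, hu⟩, ⟨a, rfl⟩, hγ⟩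
    have h1 : star a * a = 1 := scalarHom_injective (n := n) <| by
      rw [map_mul, map_star, map_one]
      exact Unitary.star_mul_self_of_mem hu
    have h2 : a * star a = 1 := scalarHom_injective (n := n) <| by
      rw [map_mul, map_star, map_one]
      exact Unitary.mul_star_self_of_mem hu
    refine ⟨⟨a, Unitary.mem_iff.2 ⟨h1, h2⟩⟩, hγ.trans ?_⟩
    ext M i k
    exact conj_scalarHom a M i k
  · rintro ⟨u, hγ⟩
    refine ⟨⟨scalarHom A n u, Unitary.mem_iff.2 ⟨?_, ?_⟩⟩, ⟨u, rfl⟩, hγ.trans ?_⟩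
    · rw [← map_star, ← map_mul, Unitary.coe_star_mul_self, map_one]
    · rw [← map_star, ← map_mul, Unitary.mul_star_self_of_mem u.2, map_one]
    · ext M i k
      exact (conj_scalarHom (u : A) M i k).symm

/-- As `α ⊗ id` sends `a ⊗ I_n` to `α(a) ⊗ I_n`, it fixes all of `A ⊗ I_n` only for `α = 1`. So
`Aut₀(A, M_n(A))` and the copy of `Aut(A)` meet trivially. This gives both the injectivity of `π` on
`Aut₀(A, M_n(A))` and the trivial intersection in `Pic(A, M_n(A))`. -/
lemma eq_of_apply_eq_scalarHom [NeZero n] {α : A ≃⋆ₐ[ℂ] A}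
    {β : CStarMatrix (Fin n) (Fin n) A ≃⋆ₐ[ℂ] CStarMatrix (Fin n) (Fin n) A}
    (hβ : β ∈ autFixing (scalarMatrices A n)) (h : β = matrixAut n α) : β = 1 ∧ α = 1 := by
  have h1 : α = 1 := by
    ext a
    refine scalarHom_injective (n := n) ?_
    rw [← matrixAut_scalarHom, ← h]
    exact hβ _ ⟨a, rfl⟩
  refine ⟨?_, h1⟩
  rw [h, h1]
  rfl

/-- Every automorphism of the inclusion restricts to an automorphism of `A`. -/
lemma exists_restrict [NeZero n] (γ : autPair (scalarMatrices A n)) : ∃ α : A ≃⋆ₐ[ℂ] A,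
    ∀ a, (γ : CStarMatrix (Fin n) (Fin n) A ≃⋆ₐ[ℂ] _) (scalarHom A n a) = scalarHom A n (α a) := by
  have hi := scalarHom_injective (A := A) (n := n)
  -- Membership in `autPair` is an equivalence, so `γ` and `γ⁻¹` both preserve `A ⊗ I_n`. The chosen
  -- preimages are unique, and every algebraic identity is inherited from `γ` through the injective
  -- `scalarHom`.
  have h1 : ∀ a, ∃ b, scalarHom A n b = γ.1 (scalarHom A n a) := fun a => (γ.2 _).2 ⟨a, rfl⟩
  have h2 : ∀ a, ∃ b, scalarHom A n b = γ.1.symm (scalarHom A n a) := fun a => by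
    refine (γ.2 _).1 ?_
    rw [StarAlgEquiv.apply_symm_apply]
    exact ⟨a, rfl⟩
  choose f hf using h1
  choose g hg using h2
  refine ⟨{ toFun := f, invFun := g, left_inv := fun a => hi ?_, right_inv := fun a => hi ?_,
            map_mul' := fun a b => hi ?_, map_add' := fun a b => hi ?_, map_star' := fun a => hi ?_,
            map_smul' := fun z a => hi ?_ }, fun a => (hf a).symm⟩
  · rw [hg, hf, StarAlgEquiv.symm_apply_apply]
  · rw [hf, hg, StarAlgEquiv.apply_symm_apply]
  · simp only [hf, map_mul]
  · simp only [hf, map_add]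
  · simp only [hf, map_star]
  · simp only [hf, map_smul]

variable (A n) in
/-- The homomorphism `α ↦ α ⊗ id` from `Aut(A)` to `Aut(A, M_n(A))`. -/
def matrixAutHom : (A ≃⋆ₐ[ℂ] A) →* autPair (scalarMatrices A n) where
  toFun α := ⟨matrixAut n α, matrixAut_mem n α⟩
  map_one' := rfl
  map_mul' _ _ := rfl

end matrix

/-! ### The semidirect product decomposition of `Pic(A, M_n(A))`. -/

/-- If all classes come from automorphisms, then those of `Aut₀(A, C)` are a normal subgroup. -/
lemma PicPair.normal_range_ofAut_autFixing {C : Type u} [CStarAlgebra C] [PartialOrder C]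
    [StarOrderedRing C] {A : StarSubalgebra ℂ C} [hA : IsClosed (A : Set C)]
    (hs : Function.Surjective (PicPair.ofAut A)) :
    ((PicPair.ofAut A).comp (Subgroup.inclusion (autFixing_le_autPair A))).range.Normal where
  conj_mem := by
    rintro _ ⟨β, rfl⟩ q
    -- With `q` represented by an automorphism `γ`, it remains to see that `Aut₀(A, C)` is normal in
    -- `Aut(A, C)`: for `a ∈ A` also `γ⁻¹(a) ∈ A`, so `β` fixes it and `γ β γ⁻¹` fixes `a`.
    obtain ⟨γ, rfl⟩ := hs q
    refine ⟨⟨γ * β * γ⁻¹, fun a ha => ?_⟩, ?_⟩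
    · change γ.1 (β.1 (γ.1.symm a)) = a
      have h1 : γ.1.symm a ∈ A := ((γ⁻¹).2 a).2 ha
      rw [β.2 _ h1, StarAlgEquiv.apply_symm_apply]
    · rw [← map_inv, MonoidHom.comp_apply, MonoidHom.comp_apply, ← map_mul, ← map_mul]
      rfl

/-- Here `Int(A)` is the range of `Unitary.conjStarAlgAut`, a subgroup of `Aut(A)`, so exactness of
the sequence amounts to `hker` and `hsurj`. -/
theorem mainTheorem8 {A : Type u} [CStarAlgebra A] [PartialOrder A] [StarOrderedRing A]
    (hker : (Pic.ofAut A).ker = (Unitary.conjStarAlgAut ℂ A).range)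
    (hsurj : Function.Surjective (Pic.ofAut A)) (n : ℕ) (hn : 2 ≤ n) :
    ∃ (φ : Pic A →* MulAut (autFixing (scalarMatrices A n)))
      (e : autFixing (scalarMatrices A n) ⋊[φ] Pic A ≃* PicPair (scalarMatrices A n)),
      (∀ β, e (SemidirectProduct.inl β) = PicPair.ofAut (scalarMatrices A n)
        (Subgroup.inclusion (autFixing_le_autPair _) β)) ∧
      (∀ α : A ≃⋆ₐ[ℂ] A, e (SemidirectProduct.inr (Pic.ofAut A α)) =
        PicPair.ofAut (scalarMatrices A n) ⟨matrixAut n α, matrixAut_mem n α⟩) := by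
  have : NeZero n := ⟨by omega⟩
  have hπ : Function.Surjective (PicPair.ofAut (scalarMatrices A n)) :=
    PicPair.ofAut_surjective (hc := isClosed_scalarMatrices A n) scalarHom_injective hsurj
  have hinner : ∀ α : A ≃⋆ₐ[ℂ] A, Pic.ofAut A α = 1 ↔ ∃ u, α = Unitary.conjStarAlgAut ℂ A u := by
    intro α
    rw [← MonoidHom.mem_ker, hker]
    exact exists_congr fun u => eq_comm
  let f := (PicPair.ofAut (scalarMatrices A n)).comp
    (Subgroup.inclusion (autFixing_le_autPair (scalarMatrices A n)))
  -- The complement is the descent of `α ↦ π(α ⊗ id)` along `Aut(A) → Pic(A)`. It is well defined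
  -- because the kernel of the latter is `Int(A)`, and `π` kills `Ad(u) ⊗ id`.
  let s : Pic A →* PicPair (scalarMatrices A n) := MonoidHom.liftOfSurjective (Pic.ofAut A) hsurj
    ⟨(PicPair.ofAut (scalarMatrices A n)).comp (matrixAutHom A n), fun α hα => by
      obtain ⟨u, rfl⟩ := (hinner α).1 hα
      exact PicPair.ofAut_scalarMatrices_eq_one_iff.2 ⟨u, rfl⟩⟩
  have hs : ∀ α, s (Pic.ofAut A α) = PicPair.ofAut (scalarMatrices A n) (matrixAutHom A n α) :=
    fun α => MonoidHom.liftOfRightInverse_comp_apply _ _ _ _ α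
  have hf : Function.Injective f := (injective_iff_map_eq_one f).2 fun β hβ => by
    -- An element of the kernel of `π` is `Ad(u) ⊗ id`; if it also fixes `A` pointwise, it is the
    -- identity.
    obtain ⟨u, hu⟩ := PicPair.ofAut_scalarMatrices_eq_one_iff.1 hβ
    exact Subtype.ext (eq_of_apply_eq_scalarHom β.2 hu).1
  have : f.range.Normal := PicPair.normal_range_ofAut_autFixing hπ
  suffices h : (∀ p, s p ∈ f.range → p = 1) ∧ ∀ q, ∃ β p, q = f β * s p by
    obtain ⟨φ, e, h1, h2⟩ := SemidirectProduct.exists_mulEquiv f s hf h.1 h.2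
    exact ⟨φ, e, h1, fun α => (h2 _).trans (hs α)⟩
  constructor
  · rintro p ⟨β, hβ⟩
    obtain ⟨α, rfl⟩ := hsurj p
    rw [hs] at hβ
    have h3 : PicPair.ofAut (scalarMatrices A n) ((Subgroup.inclusion (autFixing_le_autPair _) β)⁻¹ *
        matrixAutHom A n α) = 1 := by
      rw [map_mul, map_inv, ← hβ]
      exact inv_mul_cancel _
    obtain ⟨u, hu⟩ := PicPair.ofAut_scalarMatrices_eq_one_iff.1 h3
    -- From `π(β) = π(α ⊗ id)` follows `β⁻¹ (α ⊗ id) = Ad(u) ⊗ id` for a unitary `u ∈ A`. Thus `β`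
    -- has the form `α' ⊗ id` with `α' = α Ad(u)⁻¹`; as `β` fixes `A`, `α' = 1`, and `α = Ad(u)` is
    -- trivial in `Pic(A)`.
    have h4 : (β : CStarMatrix (Fin n) (Fin n) A ≃⋆ₐ[ℂ] _) =
        matrixAut n (α * (Unitary.conjStarAlgAut ℂ A u)⁻¹) := by
      have h5 := inv_mul_eq_iff_eq_mul.1 hu
      exact eq_mul_inv_of_mul_eq h5.symm
    exact (hinner α).2 ⟨u, mul_inv_eq_one.1 (eq_of_apply_eq_scalarHom β.2 h4).2⟩
  · intro q
    obtain ⟨γ, rfl⟩ := hπ q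
    obtain ⟨α, hα⟩ := exists_restrict γ
    -- With `α` the restriction of `γ` to `A`, the factorisation is `γ = (γ (α ⊗ id)⁻¹)(α ⊗ id)`,
    -- whose first factor fixes `A` pointwise.
    refine ⟨⟨(γ * (matrixAutHom A n α)⁻¹ : autPair (scalarMatrices A n)), ?_⟩, Pic.ofAut A α, ?_⟩
    · rintro _ ⟨a, rfl⟩
      change γ.1 (matrixAut n α.symm (scalarHom A n a)) = scalarHom A n a
      rw [matrixAut_scalarHom, hα, StarAlgEquiv.apply_symm_apply]
    · rw [hs, MonoidHom.comp_apply, ← map_mul]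
      congr 1
      exact (inv_mul_cancel_right γ (matrixAutHom A n α)).symm
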